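/- All systems are finite dimensional. A bipartite state is a density matrix $\rho$ on $\mathbb{C}^{d_A}\otimes\mathbb{C}^{d_B}$, shared by Alice and Bob; $\rho^{\otimes n}$ is regarded as a bipartite state on $(\mathbb{C}^{d_A})^{\otimes n}\otimes(\mathbb{C}^{d_B})^{\otimes n}$. Let $\|M\|=\mathrm{Tr}\sqrt{M^\dagger M}$, let $T(\rho,\sigma)=\tfrac12\|\rho-\sigma\|$ be the trace distance, and let $F(\rho,\sigma)=\mathrm{Tr}\big[(\sqrt{\rho}\,\sigma\sqrt{\rho})^{1/2}\big]$ be the fidelity. Let $|\phi^+\rangle=(|00\rangle+|11\rangle)/\sqrt2$. The distillable entanglement $E_d(\rho)$ is the supremum of all rates $r\ge 0$ for which there are protocols $\Lambda_n$ of local operations and classical communication (LOCC) between Alice and Bob, acting on $n$ copies of $\rho$, such that $$\lim_{n\to\infty}T\Big(\Lambda_n[\rho^{\otimes n}],\,|\phi^+\rangle\langle\phi^+|^{\otimes\lfloor nr\rfloor}\Big)=0 .$$ A state $\rho$ is distillable if $E_d(\rho)>0$, and nondistillable otherwise. For a bipartite state $\rho$ set $$D_g(\rho)=1-\sup_{\sigma}F(\rho,\sigma),\qquad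 D_t(\rho)=\inf_{\sigma}T(\rho,\sigma),$$ where $\sigma$ ranges over all nondistillable states of the same bipartite system as $\rho$. Then, for every distillable bipartite state $\rho$, $$\lim_{n\to\infty}D_g(\rho^{\otimes n})=\lim_{n\to\infty}D_t(\rho^{\otimes n})=1 ,$$ and for every nondistillable bipartite state $\rho$, $$D_g(\rho)=D_t(\rho)=0\qquad\text{and}\qquad \lim_{n\to\infty}D_g(\rho^{\otimes n})=\lim_{n\to\infty}D_t(\rho^{\otimes n})=0 .$$ -/

import Mathlib

open Filter Topology
open scoped NNReal ENNReal Kronecker Matrix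

namespace GeometricDistillability

/- Finite-dimensional quantum systems are indexed by finite types: an operator on the bipartite
space `ℂ^A ⊗ ℂ^B` is a matrix indexed by `A × B`. -/

open scoped ComplexOrder in
/-- A quantum state (density matrix): positive semidefinite with unit trace. -/
def IsState {S : Type} [Fintype S] (ρ : Matrix S S ℂ) : Prop :=
  ρ.PosSemidef ∧ ρ.trace = 1

/-- The tensor power `ρ^{⊗ n}` of a bipartite operator, as an operator shared between
`A^{⊗ n}` (all of Alice's systems) and `B^{⊗ n}` (all of Bob's systems). -/
def tensorPow {A B : Type} (ρ : Matrix (A × B) (A × B) ℂ) (n : ℕ) :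
    Matrix ((Fin n → A) × (Fin n → B)) ((Fin n → A) × (Fin n → B)) ℂ :=
  fun p q => ∏ i, ρ (p.1 i, p.2 i) (q.1 i, q.2 i)

open scoped MatrixOrder in
/-- The trace norm `Tr √(M† M)`. -/
noncomputable def traceNorm {S : Type} [Fintype S] [DecidableEq S] (M : Matrix S S ℂ) : ℝ :=
  (Matrix.trace (CFC.sqrt (Mᴴ * M))).re

/-- The trace distance `T(ρ, σ) = ‖ρ - σ‖₁ / 2`. -/
noncomputable def traceDist {S : Type} [Fintype S] [DecidableEq S] (ρ σ : Matrix S S ℂ) : ℝ :=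
  traceNorm (ρ - σ) / 2

open scoped MatrixOrder in
/-- The (root) fidelity `F(ρ, σ) = Tr [(√ρ σ √ρ)^{1/2}]`. -/
noncomputable def fidelity {S : Type} [Fintype S] [DecidableEq S] (ρ σ : Matrix S S ℂ) : ℝ :=
  (Matrix.trace (CFC.sqrt (CFC.sqrt ρ * σ * CFC.sqrt ρ))).re

/-- `IsLOCC A' B' A B Λ`: the map `Λ` from operators on `A ⊗ B` to operators on `A' ⊗ B'` is
implemented by local operations and classical communication, in finitely many rounds.
In each round one of the parties performs a local measurement with Kraus operators `K i`, satisfying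
`∑ i, K i† K i = 1` and possibly changing that party's system; the outcome `i` is communicated to
the other party and the remaining part `Λ i` of the protocol may depend on it. (Deterministic local
channels and coarse-grained instruments are obtained by letting `Λ i` not depend on `i`, or only on
part of it.) -/
inductive IsLOCC (A' B' : Type) [Fintype A'] [Fintype B'] [DecidableEq A'] [DecidableEq B'] :
    ∀ (A B : Type) [Fintype A] [Fintype B] [DecidableEq A] [DecidableEq B],
    (Matrix (A × B) (A × B) ℂ → Matrix (A' × B') (A' × B') ℂ) → Prop
  /-- The protocol stops. -/
  | done : IsLOCC A' B' A' B' (fun ρ => ρ)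
  /-- Alice measures, and tells Bob the outcome. -/
  | alice {A B C ι : Type} [Fintype A] [Fintype B] [DecidableEq A] [DecidableEq B]
      [Fintype C] [DecidableEq C] [Fintype ι]
      (K : ι → Matrix C A ℂ) (hK : ∑ i, (K i)ᴴ * K i = 1)
      (Λ : ι → Matrix (C × B) (C × B) ℂ → Matrix (A' × B') (A' × B') ℂ)
      (hΛ : ∀ i, IsLOCC A' B' C B (Λ i)) :
      IsLOCC A' B' A B (fun ρ =>
        ∑ i, Λ i ((K i ⊗ₖ (1 : Matrix B B ℂ)) * ρ * (K i ⊗ₖ (1 : Matrix B B ℂ))ᴴ))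
  /-- Bob measures, and tells Alice the outcome. -/
  | bob {A B C ι : Type} [Fintype A] [Fintype B] [DecidableEq A] [DecidableEq B]
      [Fintype C] [DecidableEq C] [Fintype ι]
      (K : ι → Matrix C B ℂ) (hK : ∑ i, (K i)ᴴ * K i = 1)
      (Λ : ι → Matrix (A × C) (A × C) ℂ → Matrix (A' × B') (A' × B') ℂ)
      (hΛ : ∀ i, IsLOCC A' B' A C (Λ i)) :
      IsLOCC A' B' A B (fun ρ =>
        ∑ i, Λ i (((1 : Matrix A A ℂ) ⊗ₖ K i) * ρ * ((1 : Matrix A A ℂ) ⊗ₖ K i)ᴴ))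

/-- The vector `|φ⁺⟩ = (|00⟩ + |11⟩) / √2`. -/
noncomputable def phiPlusVec : Fin 2 × Fin 2 → ℂ :=
  fun p => if p.1 = p.2 then ((Real.sqrt 2)⁻¹ : ℝ) else 0

/-- The maximally entangled two-qubit state (singlet) `|φ⁺⟩⟨φ⁺|`. -/
noncomputable def phiPlus : Matrix (Fin 2 × Fin 2) (Fin 2 × Fin 2) ℂ :=
  Matrix.vecMulVec phiPlusVec (star phiPlusVec)

section

variable {A B : Type} [Fintype A] [Fintype B] [DecidableEq A] [DecidableEq B]

/-- `r` is an achievable rate of singlet distillation from `ρ`: there are LOCC protocols `Λ n`,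
acting on `n` copies of `ρ`, with
`T (Λ n (ρ^{⊗ n}), |φ⁺⟩⟨φ⁺|^{⊗ ⌊n r⌋}) → 0` as `n → ∞`. -/
def IsAchievableRate (ρ : Matrix (A × B) (A × B) ℂ) (r : ℝ≥0) : Prop :=
  ∃ Λ : ∀ n : ℕ, Matrix ((Fin n → A) × (Fin n → B)) ((Fin n → A) × (Fin n → B)) ℂ →
      Matrix ((Fin ⌊(n : ℝ≥0) * r⌋₊ → Fin 2) × (Fin ⌊(n : ℝ≥0) * r⌋₊ → Fin 2))
        ((Fin ⌊(n : ℝ≥0) * r⌋₊ → Fin 2) × (Fin ⌊(n : ℝ≥0) * r⌋₊ → Fin 2)) ℂ,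
    (∀ n, IsLOCC _ _ (Fin n → A) (Fin n → B) (Λ n)) ∧
    Tendsto (fun n : ℕ =>
        traceDist (Λ n (tensorPow ρ n)) (tensorPow phiPlus ⌊(n : ℝ≥0) * r⌋₊))
      atTop (𝓝 0)

/-- The distillable entanglement `E_d(ρ)`: the supremum of the achievable rates. -/
noncomputable def distillableEntanglement (ρ : Matrix (A × B) (A × B) ℂ) : ℝ≥0∞ :=
  ⨆ (r : ℝ≥0) (_ : IsAchievableRate ρ r), (r : ℝ≥0∞)

/-- A state is distillable if its distillable entanglement is positive. -/
def IsDistillable (ρ : Matrix (A × B) (A × B) ℂ) : Prop :=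
  0 < distillableEntanglement ρ

variable (A B) in
/-- The set of nondistillable states of the bipartite system `A ⊗ B`. -/
def nondistillableStates : Set (Matrix (A × B) (A × B) ℂ) :=
  {σ | IsState σ ∧ ¬ IsDistillable σ}

/-- `D_g(ρ) = 1 - sup_σ F(ρ, σ)`, the supremum being over all nondistillable states `σ`. -/
noncomputable def geomDistillability (ρ : Matrix (A × B) (A × B) ℂ) : ℝ :=
  1 - sSup (fidelity ρ '' nondistillableStates A B)

/-- `D_t(ρ) = inf_σ T(ρ, σ)`, the infimum being over all nondistillable states `σ`. -/
noncomputable def traceDistillability (ρ : Matrix (A × B) (A × B) ℂ) : ℝ :=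
  sInf (traceDist ρ '' nondistillableStates A B)

end

end GeometricDistillability

/-! The crux is `overlap_le_of_not_isDistillable`: on `m` pairs of qubits, the overlap of a
nondistillable state with `m` singlets is at most of order `2 ^ (-m / 2)`. Granted this, take LOCC
protocols that turn `n` copies of a distillable state into about `n r` nearly perfect singlets. In
the Heisenberg picture, testing the output for singlets is a two-outcome measurement on the input.
Its success probability tends to `1` on the tensor powers, but to `0` uniformly over nondistillable
states, because LOCC maps these to nondistillable states. A measurement that tells two states apart
with near certainty forces their trace distance towards `1` and their fidelity towards `0`. The
nondistillable half is soft: nondistillability passes to all positive tensor powers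
(`IsDistillable.of_converts`), so the power itself competes in the supremum and the infimum.

The crux is proved by contraposition, looking only at the diagonal weights in the Bell basis, which
is labelled by a bit error and a phase error. If both parties measure the same parity check and
require equal outcomes, the error-free weight survives, while a well-chosen check removes at least
half of the weight of the nontrivial bit errors. Hadamard transforms exchange bit and phase errors.
Spending about half of the pairs on each kind (`exists_filtersTo`), an overlap above the bound comes
to dominate all errors, and one pair of fidelity close to `1` is left with positive probability.
Repeating the filter on fresh copies (`FiltersTo.exists_converts`) yields such a pair almost
deterministically.

It remains to distill nearly perfect pairs at a positive rate (`isDistillable_of_overlap_ge`), by a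
derandomized hashing protocol. A set of errors of small exponential growth carries almost all the
weight (`exists_typical_errors`), few parity checks single out one of its members
(`correctable_of_le`), and a local Pauli operation undoes it. Averaging arguments choose the checks,
so no shared randomness is needed. -/

namespace GeometricDistillability

set_option linter.unusedSectionVars false

/-! ### LOCC maps and the conversions they allow -/

section LOCC

open scoped ComplexOrder

variable {A B A' B' A'' B'' C D ι : Type} [Fintype A] [Fintype B] [DecidableEq A] [DecidableEq B]
  [Fintype A'] [Fintype B'] [DecidableEq A'] [DecidableEq B']
  [Fintype A''] [Fintype B''] [DecidableEq A''] [DecidableEq B'']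
  [Fintype C] [Fintype D] [DecidableEq C] [DecidableEq D] [Fintype ι]

theorem sum_kronecker_one_conjTranspose_mul {K : ι → Matrix C A ℂ} (hK : ∑ i, (K i)ᴴ * K i = 1) :
    ∑ i, (K i ⊗ₖ (1 : Matrix B B ℂ))ᴴ * (K i ⊗ₖ (1 : Matrix B B ℂ)) = 1 := by
  simp_rw [Matrix.conjTranspose_kronecker, ← Matrix.mul_kronecker_mul]
  have : ∑ i, ((K i)ᴴ * K i) ⊗ₖ ((1 : Matrix B B ℂ)ᴴ * 1) =
      (∑ i, (K i)ᴴ * K i) ⊗ₖ (1 : Matrix B B ℂ) := by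
    ext p q
    simp [Matrix.sum_apply, Matrix.kroneckerMap_apply, Finset.sum_mul]
  rw [this, hK, Matrix.one_kronecker_one]

theorem sum_one_kronecker_conjTranspose_mul {K : ι → Matrix C B ℂ} (hK : ∑ i, (K i)ᴴ * K i = 1) :
    ∑ i, ((1 : Matrix A A ℂ) ⊗ₖ K i)ᴴ * ((1 : Matrix A A ℂ) ⊗ₖ K i) = 1 := by
  simp_rw [Matrix.conjTranspose_kronecker, ← Matrix.mul_kronecker_mul]
  have : ∑ i, ((1 : Matrix A A ℂ)ᴴ * 1) ⊗ₖ ((K i)ᴴ * K i) =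
      (1 : Matrix A A ℂ) ⊗ₖ (∑ i, (K i)ᴴ * K i) := by
    ext p q
    simp [Matrix.sum_apply, Matrix.kroneckerMap_apply, Finset.mul_sum]
  rw [this, hK, Matrix.one_kronecker_one]

/-- Linearity is what lets a later map be moved inside the sum over measurement outcomes. -/
theorem IsLOCC.exists_linearMap {Λ : Matrix (A × B) (A × B) ℂ → Matrix (A' × B') (A' × B') ℂ}
    (h : IsLOCC A' B' A B Λ) :
    ∃ L : Matrix (A × B) (A × B) ℂ →ₗ[ℂ] Matrix (A' × B') (A' × B') ℂ, ∀ X, Λ X = L X := by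
  induction h with
  | done => exact ⟨LinearMap.id, fun _ => rfl⟩
  | alice K hK Λ hΛ ih =>
    choose L hL using ih
    refine ⟨∑ i, L i ∘ₗ mulRightLinearMap _ ℂ ((K i ⊗ₖ 1)ᴴ) ∘ₗ
      mulLeftLinearMap _ ℂ (K i ⊗ₖ 1), fun X => ?_⟩
    simp [hL]
  | bob K hK Λ hΛ ih =>
    choose L hL using ih
    refine ⟨∑ i, L i ∘ₗ mulRightLinearMap _ ℂ ((1 ⊗ₖ K i)ᴴ) ∘ₗ
      mulLeftLinearMap _ ℂ (1 ⊗ₖ K i), fun X => ?_⟩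
    simp [hL]

theorem IsLOCC.posSemidef {Λ : Matrix (A × B) (A × B) ℂ → Matrix (A' × B') (A' × B') ℂ}
    (h : IsLOCC A' B' A B Λ) : ∀ {X}, X.PosSemidef → (Λ X).PosSemidef := by
  induction h with
  | done => exact fun h => h
  | alice K hK Λ hΛ ih =>
    exact fun hX => Matrix.posSemidef_sum _ fun i _ => ih i (hX.mul_mul_conjTranspose_same _)
  | bob K hK Λ hΛ ih =>
    exact fun hX => Matrix.posSemidef_sum _ fun i _ => ih i (hX.mul_mul_conjTranspose_same _)

/-- The Heisenberg picture of an LOCC map is positive and unital. -/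
theorem IsLOCC.exists_dual {Λ : Matrix (A × B) (A × B) ℂ → Matrix (A' × B') (A' × B') ℂ}
    (h : IsLOCC A' B' A B Λ) :
    ∃ Φ : Matrix (A' × B') (A' × B') ℂ → Matrix (A × B) (A × B) ℂ, Φ 1 = 1 ∧
      (∀ M N, Φ (M - N) = Φ M - Φ N) ∧
      (∀ M, M.PosSemidef → (Φ M).PosSemidef) ∧ ∀ M X, (Φ M * X).trace = (M * Λ X).trace := by
  induction h with
  | done => exact ⟨fun M => M, rfl, fun _ _ => rfl, fun _ h => h, fun _ _ => rfl⟩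
  | @alice A B C ι _ _ _ _ _ _ _ K hK Λ hΛ ih =>
    choose Φ h1 hs hp ht using ih
    refine ⟨fun M => ∑ i, (K i ⊗ₖ (1 : Matrix B B ℂ))ᴴ * Φ i M * (K i ⊗ₖ (1 : Matrix B B ℂ)),
      ?_, fun M N => ?_, fun M hM => ?_,
      fun M X => ?_⟩
    · simp only [h1, Matrix.mul_one, sum_kronecker_one_conjTranspose_mul hK]
    · simp only [hs, Matrix.mul_sub, Matrix.sub_mul, Finset.sum_sub_distrib]
    · exact Matrix.posSemidef_sum _ fun i _ => (hp i M hM).conjTranspose_mul_mul_same _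
    · rw [Matrix.sum_mul, Matrix.mul_sum, Matrix.trace_sum, Matrix.trace_sum]
      refine Finset.sum_congr rfl fun i _ => ?_
      rw [← ht i, Matrix.mul_assoc, Matrix.mul_assoc, Matrix.trace_mul_comm]
      simp only [Matrix.mul_assoc]
  | @bob A B C ι _ _ _ _ _ _ _ K hK Λ hΛ ih =>
    choose Φ h1 hs hp ht using ih
    refine ⟨fun M => ∑ i, ((1 : Matrix A A ℂ) ⊗ₖ K i)ᴴ * Φ i M * ((1 : Matrix A A ℂ) ⊗ₖ K i),
      ?_, fun M N => ?_, fun M hM => ?_,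
      fun M X => ?_⟩
    · simp only [h1, Matrix.mul_one, sum_one_kronecker_conjTranspose_mul hK]
    · simp only [hs, Matrix.mul_sub, Matrix.sub_mul, Finset.sum_sub_distrib]
    · exact Matrix.posSemidef_sum _ fun i _ => (hp i M hM).conjTranspose_mul_mul_same _
    · rw [Matrix.sum_mul, Matrix.mul_sum, Matrix.trace_sum, Matrix.trace_sum]
      refine Finset.sum_congr rfl fun i _ => ?_
      rw [← ht i, Matrix.mul_assoc, Matrix.mul_assoc, Matrix.trace_mul_comm]
      simp only [Matrix.mul_assoc]

theorem IsLOCC.trace_eq {Λ : Matrix (A × B) (A × B) ℂ → Matrix (A' × B') (A' × B') ℂ}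
    (h : IsLOCC A' B' A B Λ) (X : Matrix (A × B) (A × B) ℂ) : (Λ X).trace = X.trace := by
  obtain ⟨Φ, h1, -, -, ht⟩ := h.exists_dual
  have := ht 1 X
  rw [h1, Matrix.one_mul, Matrix.one_mul] at this
  exact this.symm

/-- The second protocol is grafted onto every leaf of the first; its linearity distributes it over
the branches. -/
theorem IsLOCC.comp {Λ : Matrix (A × B) (A × B) ℂ → Matrix (A' × B') (A' × B') ℂ}
    {Γ : Matrix (A' × B') (A' × B') ℂ → Matrix (A'' × B'') (A'' × B'') ℂ}
    (hΓ : IsLOCC A'' B'' A' B' Γ) (hΛ : IsLOCC A' B' A B Λ) :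
    IsLOCC A'' B'' A B (fun X => Γ (Λ X)) := by
  obtain ⟨L, hL⟩ := hΓ.exists_linearMap
  induction hΛ with
  | done => exact hΓ
  | alice K hK Λ hΛ ih =>
    have := IsLOCC.alice K hK (fun i X => Γ (Λ i X)) ih
    simpa only [hL, map_sum] using this
  | bob K hK Λ hΛ ih =>
    have := IsLOCC.bob K hK (fun i X => Γ (Λ i X)) ih
    simpa only [hL, map_sum] using this

/-- The tensor product of two bipartite operators, as an operator shared between `A ⊗ C` and
`B ⊗ D`. -/
def bitensor (X : Matrix (A × B) (A × B) ℂ) (Z : Matrix (C × D) (C × D) ℂ) :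
    Matrix ((A × C) × (B × D)) ((A × C) × (B × D)) ℂ :=
  (X ⊗ₖ Z).submatrix (Equiv.prodProdProdComm A C B D) (Equiv.prodProdProdComm A C B D)

theorem kronecker_conj_bitensor (K : Matrix A' A ℂ) (L : Matrix B' B ℂ)
    (X : Matrix (A × B) (A × B) ℂ) (Z : Matrix (C × D) (C × D) ℂ) :
    ((K ⊗ₖ (1 : Matrix C C ℂ)) ⊗ₖ (L ⊗ₖ (1 : Matrix D D ℂ))) * bitensor X Z *
      ((K ⊗ₖ (1 : Matrix C C ℂ)) ⊗ₖ (L ⊗ₖ (1 : Matrix D D ℂ)))ᴴ =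
    bitensor ((K ⊗ₖ L) * X * (K ⊗ₖ L)ᴴ) Z := by
  have h : (K ⊗ₖ (1 : Matrix C C ℂ)) ⊗ₖ (L ⊗ₖ (1 : Matrix D D ℂ)) =
      ((K ⊗ₖ L) ⊗ₖ (1 : Matrix (C × D) (C × D) ℂ)).submatrix
        (Equiv.prodProdProdComm A' C B' D) (Equiv.prodProdProdComm A C B D) := by
    rw [← Matrix.one_kronecker_one]
    ext p q
    simp only [Matrix.kroneckerMap_apply, Matrix.submatrix_apply, Equiv.prodProdProdComm_apply]
    ring
  rw [h, bitensor, bitensor, Matrix.conjTranspose_submatrix, Matrix.submatrix_mul_equiv,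
    Matrix.submatrix_mul_equiv, Matrix.conjTranspose_kronecker, ← Matrix.mul_kronecker_mul,
    ← Matrix.mul_kronecker_mul]
  simp

theorem bitensor_sum_left (X : ι → Matrix (A × B) (A × B) ℂ) (Z : Matrix (C × D) (C × D) ℂ) :
    bitensor (∑ i, X i) Z = ∑ i, bitensor (X i) Z := by
  ext p q
  simp [bitensor, Matrix.sum_apply, Matrix.kroneckerMap_apply, Finset.sum_mul]

/-- Tensoring each Kraus operator with the identity lets a protocol run beside a spectator system.
-/
theorem IsLOCC.exists_bitensor {Λ : Matrix (A × B) (A × B) ℂ → Matrix (A' × B') (A' × B') ℂ}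
    (h : IsLOCC A' B' A B Λ) (C D : Type) [Fintype C] [Fintype D] [DecidableEq C] [DecidableEq D] :
    ∃ Γ, IsLOCC (A' × C) (B' × D) (A × C) (B × D) Γ ∧
      ∀ X (Z : Matrix (C × D) (C × D) ℂ), Γ (bitensor X Z) = bitensor (Λ X) Z := by
  induction h with
  | done => exact ⟨_, IsLOCC.done, fun _ _ => rfl⟩
  | alice K hK Λ hΛ ih =>
    choose Γ hΓ h using ih
    refine ⟨_, IsLOCC.alice (fun i => K i ⊗ₖ (1 : Matrix C C ℂ))
      (sum_kronecker_one_conjTranspose_mul hK) Γ hΓ, fun X Z => ?_⟩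
    simp only [← Matrix.one_kronecker_one (m := _) (n := D), kronecker_conj_bitensor, h,
      bitensor_sum_left]
  | bob K hK Λ hΛ ih =>
    choose Γ hΓ h using ih
    refine ⟨_, IsLOCC.bob (fun i => K i ⊗ₖ (1 : Matrix D D ℂ))
      (sum_kronecker_one_conjTranspose_mul hK) Γ hΓ, fun X Z => ?_⟩
    simp only [← Matrix.one_kronecker_one (m := _) (n := C), kronecker_conj_bitensor, h,
      bitensor_sum_left]

/-- `X` can be converted into `Y` by LOCC. -/
def Converts (X : Matrix (A × B) (A × B) ℂ) (Y : Matrix (A' × B') (A' × B') ℂ) : Prop :=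
  ∃ Λ, IsLOCC A' B' A B Λ ∧ Λ X = Y

theorem Converts.refl (X : Matrix (A × B) (A × B) ℂ) : Converts X X := ⟨_, IsLOCC.done, rfl⟩

theorem Converts.trans {X : Matrix (A × B) (A × B) ℂ} {Y : Matrix (A' × B') (A' × B') ℂ}
    {Z : Matrix (A'' × B'') (A'' × B'') ℂ} (h : Converts X Y) (h' : Converts Y Z) :
    Converts X Z := by
  obtain ⟨Λ, hΛ, rfl⟩ := h
  obtain ⟨Γ, hΓ, rfl⟩ := h'
  exact ⟨_, hΓ.comp hΛ, rfl⟩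

theorem Converts.smul {X : Matrix (A × B) (A × B) ℂ} {Y : Matrix (A' × B') (A' × B') ℂ}
    (h : Converts X Y) (c : ℂ) : Converts (c • X) (c • Y) := by
  obtain ⟨Λ, hΛ, rfl⟩ := h
  obtain ⟨L, hL⟩ := hΛ.exists_linearMap
  exact ⟨Λ, hΛ, by simp [hL]⟩

theorem Converts.bitensor_left {X : Matrix (A × B) (A × B) ℂ} {Y : Matrix (A' × B') (A' × B') ℂ}
    (h : Converts X Y) (Z : Matrix (C × D) (C × D) ℂ) : Converts (bitensor X Z) (bitensor Y Z) := by
  obtain ⟨Λ, hΛ, rfl⟩ := h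
  obtain ⟨Γ, hΓ, h⟩ := hΛ.exists_bitensor C D
  exact ⟨Γ, hΓ, h X Z⟩

theorem Converts.trace_eq {X : Matrix (A × B) (A × B) ℂ} {Y : Matrix (A' × B') (A' × B') ℂ}
    (h : Converts X Y) : Y.trace = X.trace := by
  obtain ⟨Λ, hΛ, rfl⟩ := h
  exact hΛ.trace_eq X

theorem Converts.posSemidef {X : Matrix (A × B) (A × B) ℂ} {Y : Matrix (A' × B') (A' × B') ℂ}
    (h : Converts X Y) (hX : X.PosSemidef) : Y.PosSemidef := by
  obtain ⟨Λ, hΛ, rfl⟩ := h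
  exact hΛ.posSemidef hX

theorem Converts.isState {X : Matrix (A × B) (A × B) ℂ} {Y : Matrix (A' × B') (A' × B') ℂ}
    (h : Converts X Y) (hX : IsState X) : IsState Y :=
  ⟨h.posSemidef hX.1, h.trace_eq.trans hX.2⟩

theorem Converts.of_alice (X : Matrix (A × B) (A × B) ℂ) (K : ι → Matrix C A ℂ)
    (hK : ∑ i, (K i)ᴴ * K i = 1) (Z : ι → Matrix (A' × B') (A' × B') ℂ)
    (h : ∀ i, Converts ((K i ⊗ₖ (1 : Matrix B B ℂ)) * X * (K i ⊗ₖ (1 : Matrix B B ℂ))ᴴ) (Z i)) :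
    Converts X (∑ i, Z i) := by
  choose Λ hΛ h using h
  exact ⟨_, IsLOCC.alice K hK Λ hΛ, Finset.sum_congr rfl fun i _ => h i⟩

theorem Converts.of_bob (X : Matrix (A × B) (A × B) ℂ) (K : ι → Matrix C B ℂ)
    (hK : ∑ i, (K i)ᴴ * K i = 1) (Z : ι → Matrix (A' × B') (A' × B') ℂ)
    (h : ∀ i, Converts (((1 : Matrix A A ℂ) ⊗ₖ K i) * X * ((1 : Matrix A A ℂ) ⊗ₖ K i)ᴴ) (Z i)) :
    Converts X (∑ i, Z i) := by
  choose Λ hΛ h using h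
  exact ⟨_, IsLOCC.bob K hK Λ hΛ, Finset.sum_congr rfl fun i _ => h i⟩

/-- Alice and Bob both measure and tell each other the outcomes. -/
theorem Converts.of_measure {κ : Type} [Fintype κ] (X : Matrix (A × B) (A × B) ℂ)
    (K : ι → Matrix C A ℂ) (hK : ∑ i, (K i)ᴴ * K i = 1)
    (L : κ → Matrix D B ℂ) (hL : ∑ j, (L j)ᴴ * L j = 1)
    (Z : ι → κ → Matrix (A' × B') (A' × B') ℂ)
    (h : ∀ i j, Converts ((K i ⊗ₖ L j) * X * (K i ⊗ₖ L j)ᴴ) (Z i j)) :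
    Converts X (∑ i, ∑ j, Z i j) := by
  refine .of_alice X K hK _ fun i => .of_bob _ L hL _ fun j => ?_
  have e : K i ⊗ₖ L j = ((1 : Matrix C C ℂ) ⊗ₖ L j) * (K i ⊗ₖ (1 : Matrix B B ℂ)) := by
    rw [← Matrix.mul_kronecker_mul, Matrix.one_mul, Matrix.mul_one]
  have := h i j
  rw [e, Matrix.conjTranspose_mul] at this
  simpa only [Matrix.mul_assoc] using this

theorem Converts.of_isometry (X : Matrix (A × B) (A × B) ℂ) (K : Matrix C A ℂ) (hK : Kᴴ * K = 1)
    (L : Matrix D B ℂ) (hL : Lᴴ * L = 1) : Converts X ((K ⊗ₖ L) * X * (K ⊗ₖ L)ᴴ) := by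
  simpa using Converts.of_measure (ι := Unit) (κ := Unit) X (fun _ => K) (by simpa using hK)
    (fun _ => L) (by simpa using hL) (fun _ _ => (K ⊗ₖ L) * X * (K ⊗ₖ L)ᴴ) fun _ _ => .refl _

/-- The block of `X` in which Alice's system is split as `S ⊗ C` and Bob's as `T ⊗ D`, and the
classical values of the `S` and `T` parts are `s` and `t`. -/
def block {S T : Type} (e : A ≃ S × C) (f : B ≃ T × D) (X : Matrix (A × B) (A × B) ℂ) (s : S)
    (t : T) : Matrix (C × D) (C × D) ℂ :=
  X.submatrix (fun p => (e.symm (s, p.1), f.symm (t, p.2)))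
    (fun p => (e.symm (s, p.1), f.symm (t, p.2)))

theorem block_posSemidef {S T : Type} (e : A ≃ S × C) (f : B ≃ T × D)
    {X : Matrix (A × B) (A × B) ℂ} (hX : X.PosSemidef) (s : S) (t : T) :
    (block e f X s t).PosSemidef := hX.submatrix _

theorem sum_selection {S : Type} [Fintype S] (e : A ≃ S × C) :
    ∑ s, ((1 : Matrix A A ℂ).submatrix (fun c => e.symm (s, c)) id)ᴴ *
      ((1 : Matrix A A ℂ).submatrix (fun c => e.symm (s, c)) id) = 1 := by
  ext a a'
  have : ∑ p : S × C, star ((1 : Matrix A A ℂ) (e.symm p) a) * (1 : Matrix A A ℂ) (e.symm p) a' =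
      (1 : Matrix A A ℂ) a a' := by
    rw [← Equiv.sum_comp e]
    by_cases h : a = a' <;> simp [Matrix.one_apply, h, eq_comm]
  rw [← this, Fintype.sum_prod_type, Matrix.sum_apply]
  rfl

/-- The selection matrices of `sum_selection` are Kraus operators that read the classical registers
and drop them. All protocols below that branch on measured bits have this form. -/
theorem Converts.of_block {S T : Type} [Fintype S] [Fintype T] (e : A ≃ S × C) (f : B ≃ T × D)
    (X : Matrix (A × B) (A × B) ℂ) (Z : S → T → Matrix (A' × B') (A' × B') ℂ)
    (h : ∀ s t, Converts (block e f X s t) (Z s t)) : Converts X (∑ s, ∑ t, Z s t) := by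
  refine .of_measure X _ (sum_selection e) _ (sum_selection f) Z fun s t => ?_
  convert h s t using 1
  have e1 : ((1 : Matrix A A ℂ).submatrix (fun c => e.symm (s, c)) id) ⊗ₖ
      ((1 : Matrix B B ℂ).submatrix (fun c => f.symm (t, c)) id) =
      (1 : Matrix (A × B) (A × B) ℂ).submatrix
        (fun p => (e.symm (s, p.1), f.symm (t, p.2))) id := by
    rw [← Matrix.one_kronecker_one]; rfl
  rw [e1, Matrix.conjTranspose_submatrix, block]
  ext p q
  simp [Matrix.mul_apply, Matrix.one_apply]

theorem Converts.reindex (e : A ≃ C) (f : B ≃ D) (X : Matrix (A × B) (A × B) ℂ) :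
    Converts X (X.submatrix (e.prodCongr f).symm (e.prodCongr f).symm) := by
  -- With one-point registers there is a single block, and selecting it is the relabelling.
  have := Converts.of_block (e.trans (Equiv.punitProd C).symm) (f.trans (Equiv.punitProd D).symm) X
    (fun _ _ => X.submatrix (e.prodCongr f).symm (e.prodCongr f).symm) fun _ _ => .refl _
  simpa using this

theorem bitensor_apply (X : Matrix (A × B) (A × B) ℂ) (Z : Matrix (C × D) (C × D) ℂ) (p q) :
    bitensor X Z p q = X (p.1.1, p.2.1) (q.1.1, q.2.1) * Z (p.1.2, p.2.2) (q.1.2, q.2.2) := rfl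

/-- Discarding the first system. -/
theorem Converts.discard_left (X : Matrix (A × B) (A × B) ℂ) (Z : Matrix (C × D) (C × D) ℂ) :
    Converts (bitensor X Z) (X.trace • Z) := by
  have := Converts.of_block (Equiv.refl (A × C)) (Equiv.refl (B × D)) (bitensor X Z)
    (fun a b => X (a, b) (a, b) • Z) fun a b => .refl _
  simpa [← Finset.sum_smul, Matrix.trace, Fintype.sum_prod_type] using this

/-- Discarding one factor is LOCC, hence preserves the trace, and its output has the product as its
trace. -/
theorem bitensor_trace (X : Matrix (A × B) (A × B) ℂ) (Z : Matrix (C × D) (C × D) ℂ) :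
    (bitensor X Z).trace = X.trace * Z.trace := by
  rw [← (Converts.discard_left X Z).trace_eq, Matrix.trace_smul, smul_eq_mul]

theorem bitensor_posSemidef {X : Matrix (A × B) (A × B) ℂ} {Z : Matrix (C × D) (C × D) ℂ}
    (hX : X.PosSemidef) (hZ : Z.PosSemidef) : (bitensor X Z).PosSemidef :=
  (hX.kronecker hZ).submatrix _

theorem Converts.bitensor_comm (X : Matrix (A × B) (A × B) ℂ) (Z : Matrix (C × D) (C × D) ℂ) :
    Converts (bitensor X Z) (bitensor Z X) := by
  convert Converts.reindex (Equiv.prodComm A C) (Equiv.prodComm B D) (bitensor X Z) using 1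
  ext p q
  simp [bitensor_apply, mul_comm]

theorem Converts.bitensor {X : Matrix (A × B) (A × B) ℂ} {X' : Matrix (A' × B') (A' × B') ℂ}
    {C' D' : Type} [Fintype C'] [Fintype D'] [DecidableEq C'] [DecidableEq D']
    {Z : Matrix (C × D) (C × D) ℂ} {Z' : Matrix (C' × D') (C' × D') ℂ}
    (h : Converts X X') (h' : Converts Z Z') :
    Converts (bitensor X Z) (bitensor X' Z') :=
  (h.bitensor_left Z).trans <| (Converts.bitensor_comm _ _).trans <|
    (h'.bitensor_left X').trans <| Converts.bitensor_comm _ _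

/-- Replacing the state by a fixed local basis state. -/
theorem Converts.of_prepare (X : Matrix (A × B) (A × B) ℂ) (c : C) (d : D) :
    Converts X (X.trace • Matrix.single (c, d) (c, d) 1) := by
  have hK : ∀ {A C : Type} [Fintype A] [DecidableEq A] [Fintype C] [DecidableEq C] (c : C),
      ∑ a : A, (Matrix.single c a (1 : ℂ))ᴴ * Matrix.single c a (1 : ℂ) = 1 := by
    intro A C _ _ _ _ c
    simp [Matrix.conjTranspose_single, Matrix.sum_single_one]
  have := Converts.of_measure X (fun a : A => Matrix.single c a 1) (hK c)
    (fun b : B => Matrix.single d b 1) (hK d)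
    (fun a b => X (a, b) (a, b) • Matrix.single (c, d) (c, d) 1) fun a b => by
      rw [Matrix.single_kronecker_single, Matrix.conjTranspose_single, Matrix.single_mul_mul_single]
      have e : (1 * 1 * X (a, b) (a, b) * star (1 * 1)) = X (a, b) (a, b) := by simp
      rw [e, Matrix.smul_single, smul_eq_mul, mul_one]
      exact Converts.refl _
  simpa only [← Finset.sum_smul, Matrix.trace, Fintype.sum_prod_type, Matrix.diag_apply] using this

end LOCC

/-! ### Trace distance and fidelity -/

section TraceNorm

open scoped ComplexOrder MatrixOrder

variable {S : Type} [Fintype S] [DecidableEq S]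

theorem re_trace_conjTranspose_mul_self (A : Matrix S S ℂ) :
    (Aᴴ * A).trace.re = ∑ p : S × S, ‖A p.1 p.2‖ ^ 2 := by
  rw [Fintype.sum_prod_type, Finset.sum_comm]
  simp only [Matrix.trace, Matrix.diag_apply, Matrix.mul_apply, Matrix.conjTranspose_apply,
    Complex.re_sum]
  refine Finset.sum_congr rfl fun i _ => Finset.sum_congr rfl fun j _ => ?_
  rw [Complex.star_def, ← Complex.normSq_eq_conj_mul_self, Complex.ofReal_re, Complex.normSq_eq_norm_sq]

theorem re_trace_conjTranspose_mul_le (A B : Matrix S S ℂ) :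
    (Aᴴ * B).trace.re ≤ √(Aᴴ * A).trace.re * √(Bᴴ * B).trace.re := by
  rw [re_trace_conjTranspose_mul_self, re_trace_conjTranspose_mul_self]
  refine le_trans ?_ (Real.sum_mul_le_sqrt_mul_sqrt _ _ _)
  rw [Fintype.sum_prod_type, Finset.sum_comm]
  simp only [Matrix.trace, Matrix.diag_apply, Matrix.mul_apply, Matrix.conjTranspose_apply,
    Complex.re_sum]
  refine Finset.sum_le_sum fun i _ => Finset.sum_le_sum fun j _ => ?_
  refine (Complex.re_le_norm _).trans_eq ?_
  rw [norm_mul, norm_star]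

/-- A square root of a positive semidefinite matrix. -/
theorem _root_.Matrix.PosSemidef.exists_hermitian_sq {M : Matrix S S ℂ} (hM : M.PosSemidef) :
    ∃ R : Matrix S S ℂ, Rᴴ = R ∧ R * R = M ∧ R = CFC.sqrt M := by
  have h0 : 0 ≤ M := Matrix.nonneg_iff_posSemidef.mpr hM
  exact ⟨CFC.sqrt M, IsSelfAdjoint.of_nonneg (CFC.sqrt_nonneg M), CFC.sqrt_mul_sqrt_self M h0, rfl⟩

theorem re_trace_mul_nonneg {M N : Matrix S S ℂ} (hM : M.PosSemidef) (hN : N.PosSemidef) :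
    0 ≤ (M * N).trace.re := by
  obtain ⟨C, hC, rfl, -⟩ := hN.exists_hermitian_sq
  rw [← Matrix.mul_assoc, Matrix.trace_mul_comm, ← Matrix.mul_assoc]
  have := (Complex.nonneg_iff.mp (hM.mul_mul_conjTranspose_same C).trace_nonneg).1
  rwa [hC] at this

theorem re_trace_nonneg {M : Matrix S S ℂ} (hM : M.PosSemidef) : 0 ≤ M.trace.re :=
  (Complex.nonneg_iff.mp hM.trace_nonneg).1

/-- The trace norm is attained: `Tr √(X† X) = Tr (U X)` for a contraction `U`. -/
theorem exists_contraction_trace_sqrt (X : Matrix S S ℂ) :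
    ∃ U : Matrix S S ℂ, (1 - U * Uᴴ).PosSemidef ∧ CFC.sqrt (Xᴴ * X) = U * X := by
  set Y := CFC.sqrt (Xᴴ * X) with hY
  have hY0 : 0 ≤ Y := CFC.sqrt_nonneg _
  have hYs : IsSelfAdjoint Y := IsSelfAdjoint.of_nonneg hY0
  have hYY : Y * Y = Xᴴ * X := CFC.sqrt_mul_sqrt_self _
    (Matrix.nonneg_iff_posSemidef.mpr (Matrix.posSemidef_conjTranspose_mul_self X))
  have hc : ∀ f : ℝ → ℝ, ContinuousOn f (spectrum ℝ Y) := fun f =>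
    (Matrix.finite_real_spectrum (A := Y)).continuousOn f
  -- As `0⁻¹ = 0`, this is the pseudo-inverse of `Y`; `W * Xᴴ` is then the adjoint of the partial
  -- isometry in the polar decomposition of `X`.
  set W := cfc (fun x : ℝ => x⁻¹) Y with hW
  have hWs : Wᴴ = W := (cfc_predicate (fun x : ℝ => x⁻¹) Y : IsSelfAdjoint W)
  have hid : cfc (fun x : ℝ => x) Y = Y := cfc_id' ℝ Y
  have hWY : W * Y = cfc (fun x : ℝ => x⁻¹ * x) Y := by
    rw [cfc_mul _ _ Y (hc _) (hc _), hid]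
  have hYW : Y * W = W * Y := by
    rw [hWY, cfc_congr (g := fun x : ℝ => x * x⁻¹) (fun x _ => mul_comm _ _),
      cfc_mul _ _ Y (hc _) (hc _), hid]
  have hWYY : W * Y * Y = Y := by
    conv_lhs => rw [hWY]
    nth_rw 2 [← hid]
    rw [← cfc_mul _ _ Y (hc _) (hc _), cfc_congr (g := fun x : ℝ => x), hid]
    intro x _
    by_cases h : x = 0 <;> simp [h]
  refine ⟨W * Xᴴ, ?_, ?_⟩
  -- `P` is the projection onto the support of `Y`, and `U * Uᴴ = P`.
  · set P := W * Y with hP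
    have hPs : Pᴴ = P := by
      rw [hP, Matrix.conjTranspose_mul, hWs, ← hP, ← hYW]
      exact congrArg (· * W) hYs
    have hPP : P * P = P := by
      nth_rw 2 [← hYW]
      rw [← Matrix.mul_assoc, hWYY, hYW]
    have : 1 - W * Xᴴ * (W * Xᴴ)ᴴ = (1 - P)ᴴ * (1 - P) := by
      rw [Matrix.conjTranspose_sub, Matrix.conjTranspose_one, hPs, Matrix.conjTranspose_mul,
        Matrix.conjTranspose_conjTranspose, hWs]
      have : W * Xᴴ * (X * W) = P := by
        rw [Matrix.mul_assoc, ← Matrix.mul_assoc Xᴴ, ← hYY, ← Matrix.mul_assoc, ← Matrix.mul_assoc,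
          hWYY, hYW]
      rw [this]
      noncomm_ring
      rw [hPP]
      abel
    rw [this]
    exact Matrix.posSemidef_conjTranspose_mul_self _
  · rw [Matrix.mul_assoc, ← hYY, ← Matrix.mul_assoc, hWYY]

/-- Cauchy–Schwarz for the Hilbert–Schmidt inner product of `Uᴴ * C` and `B`; the contraction cannot
increase the norm of `C`. It serves to bound a trace norm after writing its argument as a sum of
products. -/
theorem re_trace_contraction_mul_le {U : Matrix S S ℂ} (hU : (1 - U * Uᴴ).PosSemidef)
    (B C : Matrix S S ℂ) :
    (U * (B * Cᴴ)).trace.re ≤ √(Bᴴ * B).trace.re * √(Cᴴ * C).trace.re := by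
  have h := re_trace_conjTranspose_mul_le (Uᴴ * C) B
  have e : ((Uᴴ * C)ᴴ * B).trace = (U * (B * Cᴴ)).trace := by
    rw [Matrix.conjTranspose_mul, Matrix.conjTranspose_conjTranspose, Matrix.mul_assoc,
      Matrix.trace_mul_comm, Matrix.mul_assoc]
  rw [e] at h
  refine h.trans ?_
  rw [mul_comm]
  refine mul_le_mul_of_nonneg_left (Real.sqrt_le_sqrt ?_) (Real.sqrt_nonneg _)
  have h2 := re_trace_nonneg (hU.conjTranspose_mul_mul_same C)
  have e2 : Cᴴ * (1 - U * Uᴴ) * C = Cᴴ * C - (Uᴴ * C)ᴴ * (Uᴴ * C) := by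
    rw [Matrix.conjTranspose_mul, Matrix.conjTranspose_conjTranspose]
    noncomm_ring
  rw [e2, Matrix.trace_sub, Complex.sub_re] at h2
  linarith

theorem traceNorm_nonneg (X : Matrix S S ℂ) : 0 ≤ traceNorm X :=
  re_trace_nonneg (Matrix.nonneg_iff_posSemidef.mp (CFC.sqrt_nonneg _))

theorem traceDist_nonneg (ρ σ : Matrix S S ℂ) : 0 ≤ traceDist ρ σ :=
  div_nonneg (traceNorm_nonneg _) zero_le_two

theorem fidelity_nonneg (ρ σ : Matrix S S ℂ) : 0 ≤ fidelity ρ σ :=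
  re_trace_nonneg (Matrix.nonneg_iff_posSemidef.mp (CFC.sqrt_nonneg _))

theorem traceDist_self (ρ : Matrix S S ℂ) : traceDist ρ ρ = 0 := by
  simp [traceDist, traceNorm]

/-- A two-outcome measurement bounds the trace distance from below. -/
theorem re_trace_mul_sub_le_traceDist {ρ σ M : Matrix S S ℂ} (hρ : IsState ρ) (hσ : IsState σ)
    (hM : M.PosSemidef) (hM1 : (1 - M).PosSemidef) :
    (M * ρ).trace.re - (M * σ).trace.re ≤ traceDist ρ σ := by
  set X := ρ - σ with hX
  have hXs : IsSelfAdjoint X := hρ.1.isHermitian.sub hσ.1.isHermitian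
  have hpn : X⁺ - X⁻ = X := CFC.posPart_sub_negPart X hXs
  have habs : traceNorm X = (X⁺).trace.re + (X⁻).trace.re := by
    rw [← Complex.add_re, ← Matrix.trace_add, CFC.posPart_add_negPart X hXs]
    rfl
  have hp : (X⁺).PosSemidef := Matrix.nonneg_iff_posSemidef.mp (CFC.posPart_nonneg X)
  have hn : (X⁻).PosSemidef := Matrix.nonneg_iff_posSemidef.mp (CFC.negPart_nonneg X)
  -- The positive and negative parts have equal trace, so the trace distance is the trace of `X⁺`.
  have htr : (X⁺).trace.re - (X⁻).trace.re = 0 := by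
    rw [← Complex.sub_re, ← Matrix.trace_sub, hpn, hX, Matrix.trace_sub, hρ.2, hσ.2]
    simp
  have h1 : (M * ρ).trace.re - (M * σ).trace.re = (M * X⁺).trace.re - (M * X⁻).trace.re := by
    rw [← Complex.sub_re, ← Complex.sub_re, ← Matrix.trace_sub, ← Matrix.trace_sub,
      ← Matrix.mul_sub, ← Matrix.mul_sub, hpn]
  have h2 := re_trace_mul_nonneg hM hn
  have h3 := re_trace_mul_nonneg hM1 hp
  rw [Matrix.sub_mul, Matrix.one_mul, Matrix.trace_sub, Complex.sub_re] at h3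
  rw [traceDist, habs]
  linarith

/-- A two-outcome measurement bounds the fidelity from above. -/
theorem fidelity_le {ρ σ M : Matrix S S ℂ} (hρ : ρ.PosSemidef) (hσ : σ.PosSemidef)
    (hM : M.PosSemidef) (hM1 : (1 - M).PosSemidef) :
    fidelity ρ σ ≤ √(M * σ).trace.re * √(M * ρ).trace.re +
      √((1 - M) * σ).trace.re * √((1 - M) * ρ).trace.re := by
  obtain ⟨R, hR, hRR, hRs⟩ := hρ.exists_hermitian_sq
  obtain ⟨Q, hQ, hQQ, -⟩ := hσ.exists_hermitian_sq
  obtain ⟨U, hU, hUX⟩ := exists_contraction_trace_sqrt (Q * R)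
  have hF : fidelity ρ σ = (U * (Q * R)).trace.re := by
    rw [← hUX, fidelity, ← hRs, Matrix.conjTranspose_mul, hR, hQ, ← hQQ]
    simp only [Matrix.mul_assoc]
  have key : ∀ N : Matrix S S ℂ, N.PosSemidef →
      (U * (Q * N * R)).trace.re ≤ √(N * σ).trace.re * √(N * ρ).trace.re := by
    intro N hN
    obtain ⟨P, hP, hPP, -⟩ := hN.exists_hermitian_sq
    have := re_trace_contraction_mul_le hU (Q * P) (R * P)
    have e : ∀ R ρ : Matrix S S ℂ, Rᴴ = R → R * R = ρ →
        ((R * P)ᴴ * (R * P)).trace = (N * ρ).trace := by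
      intro R ρ hR hRR
      rw [Matrix.conjTranspose_mul, hR, hP, Matrix.mul_assoc, ← Matrix.mul_assoc R, hRR,
        Matrix.trace_mul_comm, Matrix.mul_assoc, hPP, Matrix.trace_mul_comm]
    rw [e Q σ hQ hQQ, e R ρ hR hRR, Matrix.conjTranspose_mul, hR, hP] at this
    rw [← hPP]
    rw [← hPP] at this
    simpa only [Matrix.mul_assoc] using this
  -- Inserting `1 = M + (1 - M)` between the two square roots reduces the bound to one
  -- Cauchy–Schwarz inequality per outcome.
  have e : U * (Q * R) = U * (Q * M * R) + U * (Q * (1 - M) * R) := by noncomm_ring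
  rw [hF, e, Matrix.trace_add, Complex.add_re]
  exact add_le_add (key M hM) (key _ hM1)

theorem fidelity_le_one {ρ σ : Matrix S S ℂ} (hρ : IsState ρ) (hσ : IsState σ) :
    fidelity ρ σ ≤ 1 := by
  have := fidelity_le hρ.1 hσ.1 Matrix.PosSemidef.one (by simpa using Matrix.PosSemidef.zero)
  simpa [hρ.2, hσ.2] using this

theorem fidelity_self {ρ : Matrix S S ℂ} (hρ : IsState ρ) : fidelity ρ ρ = 1 := by
  obtain ⟨R, hR, hRR, hRs⟩ := hρ.1.exists_hermitian_sq
  have h0 : 0 ≤ ρ := Matrix.nonneg_iff_posSemidef.mpr hρ.1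
  have : R * ρ * R = ρ * ρ := by
    rw [← hRR]; simp only [Matrix.mul_assoc]
  rw [fidelity, ← hRs, this, CFC.sqrt_mul_self ρ h0, hρ.2, Complex.one_re]

/-- The trace distance of a state to a pure state is small if the overlap is close to one. -/
theorem traceDist_pure_le {ω Φ : Matrix S S ℂ} (hω : IsState ω) (hΦ : Φᴴ = Φ) (hΦΦ : Φ * Φ = Φ)
    (hΦ1 : Φ.trace = 1) (hp : Φ * ω * Φ = (Φ * ω).trace • Φ) (hF : (Φ * ω).trace.re ≤ 1) :
    traceDist ω Φ ≤ (1 - (Φ * ω).trace.re) / 2 + √(1 - (Φ * ω).trace.re) := by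
  obtain ⟨R, hR, hRR, -⟩ := hω.1.exists_hermitian_sq
  obtain ⟨U, hU, hUX⟩ := exists_contraction_trace_sqrt (ω - Φ)
  set f := (Φ * ω).trace.re with hf
  have hΦp : Φ.PosSemidef := by
    have := Matrix.posSemidef_conjTranspose_mul_self Φ
    rwa [hΦ, hΦΦ] at this
  have hfc : (Φ * ω).trace = (f : ℂ) := by
    refine Complex.ext rfl ?_
    have : 0 ≤ (Φ * ω).trace := by
      rw [← hRR, ← Matrix.mul_assoc, Matrix.trace_mul_comm, ← Matrix.mul_assoc]
      have := (hΦp.conjTranspose_mul_mul_same R).trace_nonneg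
      rwa [hR] at this
    simpa using (Complex.nonneg_iff.mp this).2.symm
  -- This is `ω - Φ = (f - 1) Φ + (1 - Φ) ω + Φ ω (1 - Φ)`, using `Φ ω Φ = f Φ`. The terms have
  -- trace norms at most `1 - f`, `√(1 - f)` and `√f √(1 - f)`.
  have hdecomp : ω - Φ = (((f - 1 : ℝ) : ℂ) • Φ) * Φᴴ + ((1 - Φ) * R) * Rᴴ +
      (Φ * R) * ((1 - Φ) * R)ᴴ := by
    rw [Matrix.conjTranspose_mul, Matrix.conjTranspose_sub, Matrix.conjTranspose_one, hΦ, hR,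
      Matrix.smul_mul, hΦΦ]
    have e1 : (1 - Φ) * R * R = ω - Φ * ω := by
      rw [Matrix.mul_assoc, hRR]; noncomm_ring
    have e2 : Φ * R * (R * (1 - Φ)) = Φ * ω - Φ * ω * Φ := by
      rw [Matrix.mul_assoc, ← Matrix.mul_assoc R, hRR]; noncomm_ring
    rw [e1, e2, hp, hfc]
    push_cast
    rw [sub_smul, one_smul]
    abel
  have hQ : (1 - Φ) * (1 - Φ) = 1 - Φ := by
    noncomm_ring
    rw [hΦΦ]
    abel
  have hQR : (((1 - Φ) * R)ᴴ * ((1 - Φ) * R)).trace.re = 1 - f := by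
    rw [Matrix.conjTranspose_mul, Matrix.conjTranspose_sub, Matrix.conjTranspose_one, hΦ, hR,
      Matrix.mul_assoc, ← Matrix.mul_assoc (1 - Φ), hQ, Matrix.trace_mul_comm, Matrix.mul_assoc,
      hRR, Matrix.sub_mul, Matrix.one_mul, Matrix.trace_sub, hω.2, Complex.sub_re]
    rfl
  have hΦR : ((Φ * R)ᴴ * (Φ * R)).trace.re = f := by
    rw [Matrix.conjTranspose_mul, hΦ, hR, Matrix.mul_assoc, ← Matrix.mul_assoc Φ, hΦΦ,
      Matrix.trace_mul_comm, Matrix.mul_assoc, hRR]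
  have hRR' : (Rᴴ * R).trace.re = 1 := by rw [hR, hRR, hω.2, Complex.one_re]
  have hT : traceNorm (ω - Φ) = (U * (ω - Φ)).trace.re := by rw [traceNorm, hUX]
  have b1 := re_trace_contraction_mul_le hU (((f - 1 : ℝ) : ℂ) • Φ) Φ
  have b2 := re_trace_contraction_mul_le hU ((1 - Φ) * R) R
  have b3 := re_trace_contraction_mul_le hU (Φ * R) ((1 - Φ) * R)
  rw [hQR, hRR', Real.sqrt_one, mul_one] at b2
  rw [hQR, hΦR] at b3
  have b4 : √f * √(1 - f) ≤ √(1 - f) :=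
    mul_le_of_le_one_left (Real.sqrt_nonneg _) (Real.sqrt_le_one.mpr hF)
  have b5 : ((((f - 1 : ℝ) : ℂ) • Φ)ᴴ * (((f - 1 : ℝ) : ℂ) • Φ)).trace.re = (1 - f) ^ 2 := by
    rw [Matrix.conjTranspose_smul, hΦ, Matrix.smul_mul, Matrix.mul_smul, hΦΦ, smul_smul,
      Matrix.trace_smul, hΦ1, Complex.star_def, Complex.conj_ofReal, ← Complex.ofReal_mul,
      smul_eq_mul,
      mul_one, Complex.ofReal_re]
    ring
  rw [b5, hΦ, hΦΦ, hΦ1, Complex.one_re, Real.sqrt_one, mul_one, Real.sqrt_sq (by linarith)] at b1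
  have hsum : (U * (ω - Φ)).trace.re = (U * ((((f - 1 : ℝ) : ℂ) • Φ) * Φᴴ)).trace.re +
      (U * (((1 - Φ) * R) * Rᴴ)).trace.re + (U * ((Φ * R) * ((1 - Φ) * R)ᴴ)).trace.re := by
    conv_lhs => rw [hdecomp]
    rw [Matrix.mul_add, Matrix.mul_add, Matrix.trace_add, Matrix.trace_add, Complex.add_re,
      Complex.add_re]
  rw [hΦ] at hsum
  rw [traceDist, hT, hsum]
  linarith

end TraceNorm

/-! ### Overlap with singlets -/

section Singlets

open scoped ComplexOrder

variable {A B A' B' : Type} [Fintype A] [Fintype B] [DecidableEq A] [DecidableEq B]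
  [Fintype A'] [Fintype B'] [DecidableEq A'] [DecidableEq B']

/-- The vector of `m` singlets. -/
noncomputable def singletVec (m : ℕ) : (Fin m → Fin 2) × (Fin m → Fin 2) → ℂ :=
  fun p => if p.1 = p.2 then (((Real.sqrt 2)⁻¹ ^ m : ℝ) : ℂ) else 0

theorem tensorPow_phiPlus (m : ℕ) :
    tensorPow phiPlus m = Matrix.vecMulVec (singletVec m) (star (singletVec m)) := by
  have h : ∀ p : (Fin m → Fin 2) × (Fin m → Fin 2),
      ∏ i, phiPlusVec (p.1 i, p.2 i) = singletVec m p := by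
    intro p
    by_cases hp : p.1 = p.2
    · simp [phiPlusVec, singletVec, hp]
    · obtain ⟨i, hi⟩ := Function.ne_iff.mp hp
      rw [Finset.prod_eq_zero (Finset.mem_univ i) (by simp [phiPlusVec, hi])]
      simp [singletVec, hp]
  ext p q
  rw [Matrix.vecMulVec_apply, Pi.star_apply, ← h p, ← h q, star_prod, ← Finset.prod_mul_distrib]
  rfl

theorem star_singletVec_dotProduct_self (m : ℕ) : star (singletVec m) ⬝ᵥ singletVec m = 1 := by
  have h2 : ((Real.sqrt 2)⁻¹ ^ m * (Real.sqrt 2)⁻¹ ^ m : ℝ) = (2 ^ m)⁻¹ := by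
    rw [← mul_pow, ← mul_inv, Real.mul_self_sqrt zero_le_two, inv_pow]
  have h3 : ∀ p : (Fin m → Fin 2) × (Fin m → Fin 2), star (singletVec m p) * singletVec m p =
      if p.1 = p.2 then (((2 ^ m)⁻¹ : ℝ) : ℂ) else 0 := by
    intro p
    rw [singletVec]
    split_ifs
    · rw [Complex.star_def, Complex.conj_ofReal, ← Complex.ofReal_mul, h2]
    · simp
  simp only [dotProduct, Pi.star_apply, h3, Fintype.sum_prod_type]
  simp

section Pure

variable {S : Type} [Fintype S] [DecidableEq S] {v : S → ℂ}

theorem vecMulVec_star_mul_self (hv : star v ⬝ᵥ v = 1) :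
    Matrix.vecMulVec v (star v) * Matrix.vecMulVec v (star v) = Matrix.vecMulVec v (star v) := by
  rw [Matrix.vecMulVec_mul_vecMulVec, hv, one_smul]

theorem conjTranspose_vecMulVec_star (v : S → ℂ) :
    (Matrix.vecMulVec v (star v))ᴴ = Matrix.vecMulVec v (star v) := by
  rw [Matrix.conjTranspose_vecMulVec, star_star]

theorem posSemidef_one_sub_vecMulVec (hv : star v ⬝ᵥ v = 1) :
    (1 - Matrix.vecMulVec v (star v)).PosSemidef := by
  have h : 1 - Matrix.vecMulVec v (star v) =
      (1 - Matrix.vecMulVec v (star v))ᴴ * (1 - Matrix.vecMulVec v (star v)) := by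
    rw [Matrix.conjTranspose_sub, Matrix.conjTranspose_one, conjTranspose_vecMulVec_star]
    noncomm_ring
    rw [vecMulVec_star_mul_self hv]
    abel
  rw [h]
  exact Matrix.posSemidef_conjTranspose_mul_self _

theorem trace_vecMulVec_mul (v : S → ℂ) (X : Matrix S S ℂ) :
    (Matrix.vecMulVec v (star v) * X).trace = star v ⬝ᵥ X *ᵥ v := by
  rw [Matrix.trace_mul_comm, Matrix.mul_vecMulVec, Matrix.trace_vecMulVec, dotProduct_comm]

theorem vecMulVec_mul_mul (v : S → ℂ) (X : Matrix S S ℂ) :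
    Matrix.vecMulVec v (star v) * X * Matrix.vecMulVec v (star v) =
      (Matrix.vecMulVec v (star v) * X).trace • Matrix.vecMulVec v (star v) := by
  rw [trace_vecMulVec_mul, Matrix.vecMulVec_mul, Matrix.vecMulVec_mul_vecMulVec,
    Matrix.dotProduct_mulVec, Matrix.vecMulVec_smul]

end Pure

/-- The overlap of an operator on `m` pairs of qubits with `m` singlets. -/
noncomputable def overlap {m : ℕ}
    (X : Matrix ((Fin m → Fin 2) × (Fin m → Fin 2)) ((Fin m → Fin 2) × (Fin m → Fin 2)) ℂ) : ℝ :=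
  (tensorPow phiPlus m * X).trace.re

theorem posSemidef_tensorPow_phiPlus (m : ℕ) : (tensorPow phiPlus m).PosSemidef := by
  rw [tensorPow_phiPlus]
  exact Matrix.posSemidef_vecMulVec_self_star _

theorem posSemidef_one_sub_tensorPow_phiPlus (m : ℕ) :
    (1 - tensorPow phiPlus m).PosSemidef := by
  rw [tensorPow_phiPlus]
  exact posSemidef_one_sub_vecMulVec (star_singletVec_dotProduct_self m)

theorem isState_tensorPow_phiPlus (m : ℕ) : IsState (tensorPow phiPlus m) := by
  refine ⟨posSemidef_tensorPow_phiPlus m, ?_⟩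
  rw [tensorPow_phiPlus, Matrix.trace_vecMulVec, dotProduct_comm, star_singletVec_dotProduct_self]

variable {m : ℕ} {X Y : Matrix ((Fin m → Fin 2) × (Fin m → Fin 2))
  ((Fin m → Fin 2) × (Fin m → Fin 2)) ℂ}

theorem overlap_nonneg (hX : X.PosSemidef) : 0 ≤ overlap X :=
  re_trace_mul_nonneg (posSemidef_tensorPow_phiPlus m) hX

theorem overlap_le_trace (hX : X.PosSemidef) : overlap X ≤ X.trace.re := by
  have := re_trace_mul_nonneg (posSemidef_one_sub_tensorPow_phiPlus m) hX
  rw [Matrix.sub_mul, Matrix.one_mul, Matrix.trace_sub, Complex.sub_re] at this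
  exact sub_nonneg.mp this

theorem overlap_add : overlap (X + Y) = overlap X + overlap Y := by
  rw [overlap, Matrix.mul_add, Matrix.trace_add, Complex.add_re]; rfl

theorem overlap_sum {ι : Type} (s : Finset ι) (X : ι → Matrix ((Fin m → Fin 2) × (Fin m → Fin 2))
    ((Fin m → Fin 2) × (Fin m → Fin 2)) ℂ) : overlap (∑ i ∈ s, X i) = ∑ i ∈ s, overlap (X i) := by
  simp only [overlap, Matrix.mul_sum, Matrix.trace_sum, Complex.re_sum]

theorem overlap_smul (c : ℝ) : overlap ((c : ℂ) • X) = c * overlap X := by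
  rw [overlap, Matrix.mul_smul, Matrix.trace_smul, smul_eq_mul, Complex.re_ofReal_mul]; rfl

theorem overlap_tensorPow_phiPlus (m : ℕ) : overlap (tensorPow phiPlus m) = 1 := by
  rw [overlap, tensorPow_phiPlus, vecMulVec_star_mul_self (star_singletVec_dotProduct_self m),
    ← tensorPow_phiPlus, (isState_tensorPow_phiPlus m).2, Complex.one_re]

/-- The measurement bound for the outcome "not the singlet state". Together with
`traceDist_le_of_overlap` it allows convergence in trace distance to be replaced by convergence of
the overlap, which is linear in the state. -/
theorem one_sub_overlap_le_traceDist (hX : IsState X) :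
    1 - overlap X ≤ traceDist X (tensorPow phiPlus m) := by
  have h := re_trace_mul_sub_le_traceDist (M := 1 - tensorPow phiPlus m) hX
    (isState_tensorPow_phiPlus m) (posSemidef_one_sub_tensorPow_phiPlus m)
    (by simpa using posSemidef_tensorPow_phiPlus m)
  rw [Matrix.sub_mul, Matrix.sub_mul, Matrix.one_mul, Matrix.one_mul, Matrix.trace_sub,
    Matrix.trace_sub, hX.2, (isState_tensorPow_phiPlus m).2, Complex.sub_re, Complex.sub_re] at h
  have h1 := overlap_tensorPow_phiPlus m
  rw [overlap] at h1
  rw [h1, Complex.one_re] at h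
  rw [overlap]
  linarith

theorem traceDist_le_of_overlap (hX : IsState X) :
    traceDist X (tensorPow phiPlus m) ≤ (1 - overlap X) / 2 + √(1 - overlap X) := by
  have hv := star_singletVec_dotProduct_self m
  have h1 := overlap_le_trace hX.1
  rw [hX.2, Complex.one_re] at h1
  refine traceDist_pure_le hX (posSemidef_tensorPow_phiPlus m).isHermitian ?_
    (isState_tensorPow_phiPlus m).2 ?_ h1
  · rw [tensorPow_phiPlus, vecMulVec_star_mul_self hv]
  · rw [tensorPow_phiPlus, vecMulVec_mul_mul]

end Singlets

/-! ### Tensor powers under LOCC -/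

section TensorPow

open scoped ComplexOrder

variable {A B A' B' : Type} [Fintype A] [Fintype B] [DecidableEq A] [DecidableEq B]
  [Fintype A'] [Fintype B'] [DecidableEq A'] [DecidableEq B']
  (ρ : Matrix (A × B) (A × B) ℂ)

theorem Converts.reindex_symm (e : A' ≃ A) (f : B' ≃ B) :
    Converts (ρ.submatrix (e.prodCongr f) (e.prodCongr f)) ρ := by
  have := Converts.reindex e f (ρ.submatrix (e.prodCongr f) (e.prodCongr f))
  rwa [Matrix.submatrix_submatrix, Equiv.self_comp_symm, Matrix.submatrix_id_id] at this

theorem tensorPow_add_submatrix (m n : ℕ) :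
    (tensorPow ρ (m + n)).submatrix ((Fin.appendEquiv m n).prodCongr (Fin.appendEquiv m n))
      ((Fin.appendEquiv m n).prodCongr (Fin.appendEquiv m n)) =
      bitensor (tensorPow ρ m) (tensorPow ρ n) := by
  ext p q
  simp [bitensor_apply, tensorPow, Fin.prod_univ_add, Fin.appendEquiv]

theorem converts_tensorPow_add (m n : ℕ) :
    Converts (tensorPow ρ (m + n)) (bitensor (tensorPow ρ m) (tensorPow ρ n)) := by
  rw [← tensorPow_add_submatrix]
  exact Converts.reindex (Fin.appendEquiv m n).symm (Fin.appendEquiv m n).symm _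

theorem converts_tensorPow_add_symm (m n : ℕ) :
    Converts (bitensor (tensorPow ρ m) (tensorPow ρ n)) (tensorPow ρ (m + n)) := by
  rw [← tensorPow_add_submatrix]
  exact Converts.reindex_symm _ (Fin.appendEquiv m n) (Fin.appendEquiv m n)

theorem tensorPow_one_submatrix :
    (tensorPow ρ 1) = ρ.submatrix
      ((Equiv.funUnique (Fin 1) A).prodCongr (Equiv.funUnique (Fin 1) B))
      ((Equiv.funUnique (Fin 1) A).prodCongr (Equiv.funUnique (Fin 1) B)) := by
  ext p q
  simp only [tensorPow, Finset.univ_unique, Finset.prod_singleton]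
  rfl

theorem converts_tensorPow_one_symm : Converts ρ (tensorPow ρ 1) := by
  rw [tensorPow_one_submatrix]
  exact Converts.reindex (Equiv.funUnique (Fin 1) A).symm (Equiv.funUnique (Fin 1) B).symm ρ

theorem converts_tensorPow_one : Converts (tensorPow ρ 1) ρ := by
  rw [tensorPow_one_submatrix]
  exact Converts.reindex_symm ρ _ _

theorem tensorPow_zero : tensorPow ρ 0 = 1 := by
  ext p q
  rw [Subsingleton.elim p q, Matrix.one_apply_eq]
  simp [tensorPow]

variable {ρ}

theorem isState_tensorPow (hρ : IsState ρ) (n : ℕ) : IsState (tensorPow ρ n) := by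
  induction n with
  | zero =>
    rw [tensorPow_zero]
    exact ⟨Matrix.PosSemidef.one, by simp⟩
  | succ n ih =>
    have h1 := (converts_tensorPow_one_symm ρ).isState hρ
    refine (converts_tensorPow_add_symm ρ n 1).isState ⟨bitensor_posSemidef ih.1 h1.1, ?_⟩
    rw [bitensor_trace, ih.2, h1.2, one_mul]

theorem converts_tensorPow_of_le (hρ : IsState ρ) {n m : ℕ} (h : m ≤ n) :
    Converts (tensorPow ρ n) (tensorPow ρ m) := by
  obtain ⟨d, rfl⟩ := Nat.exists_eq_add_of_le' h
  refine (converts_tensorPow_add ρ d m).trans ?_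
  simpa [(isState_tensorPow hρ d).2] using
    Converts.discard_left (tensorPow ρ d) (tensorPow ρ m)

/-- The copies are cut into `k` groups of `N`, and the protocol runs on each group separately. -/
theorem Converts.tensorPow_mul {N : ℕ} {ω : Matrix (A' × B') (A' × B') ℂ}
    (h : Converts (tensorPow ρ N) ω) (k : ℕ) :
    Converts (tensorPow ρ (k * N)) (tensorPow ω k) := by
  induction k with
  | zero =>
    rw [Nat.zero_mul]
    convert Converts.reindex (Equiv.ofUnique (Fin 0 → A) (Fin 0 → A'))
      (Equiv.ofUnique (Fin 0 → B) (Fin 0 → B')) (tensorPow ρ 0) using 1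
    ext p q
    simp [tensorPow]
  | succ k ih =>
    rw [Nat.succ_mul]
    exact (converts_tensorPow_add ρ _ _).trans <|
      (ih.bitensor (h.trans (converts_tensorPow_one_symm ω))).trans <|
      converts_tensorPow_add_symm ω k 1

end TensorPow

/-! ### Achievable rates in terms of overlap; existence of nondistillable states -/

section Distillation

open scoped ComplexOrder

variable {A B A' B' : Type} [Fintype A] [Fintype B] [DecidableEq A] [DecidableEq B]
  [Fintype A'] [Fintype B'] [DecidableEq A'] [DecidableEq B']
  {ρ : Matrix (A × B) (A × B) ℂ}

theorem isDistillable_iff : IsDistillable ρ ↔ ∃ r : ℝ≥0, 0 < r ∧ IsAchievableRate ρ r := by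
  simp [IsDistillable, distillableEntanglement, lt_iSup_iff, and_comm]

theorem IsAchievableRate.exists_converts (hρ : IsState ρ) {r : ℝ≥0} (h : IsAchievableRate ρ r) :
    ∃ Λ : ∀ n : ℕ, Matrix ((Fin n → A) × (Fin n → B)) ((Fin n → A) × (Fin n → B)) ℂ →
      Matrix ((Fin ⌊(n : ℝ≥0) * r⌋₊ → Fin 2) × (Fin ⌊(n : ℝ≥0) * r⌋₊ → Fin 2))
        ((Fin ⌊(n : ℝ≥0) * r⌋₊ → Fin 2) × (Fin ⌊(n : ℝ≥0) * r⌋₊ → Fin 2)) ℂ,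
    (∀ n, IsLOCC _ _ (Fin n → A) (Fin n → B) (Λ n)) ∧
    Tendsto (fun n : ℕ => overlap (Λ n (tensorPow ρ n))) atTop (𝓝 1) := by
  obtain ⟨Λ, hΛ, hT⟩ := h
  refine ⟨Λ, hΛ, ?_⟩
  have hs := fun n => Converts.isState ⟨Λ n, hΛ n, rfl⟩ (isState_tensorPow hρ n)
  have hl : Tendsto (fun n : ℕ => 1 - traceDist (Λ n (tensorPow ρ n))
      (tensorPow phiPlus ⌊(n : ℝ≥0) * r⌋₊)) atTop (𝓝 1) := by
    simpa using hT.const_sub 1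
  refine tendsto_of_tendsto_of_tendsto_of_le_of_le hl tendsto_const_nhds (fun n => ?_) fun n => ?_
  · have := one_sub_overlap_le_traceDist (hs n)
    simp only
    linarith
  · have := overlap_le_trace (hs n).1
    rwa [(hs n).2, Complex.one_re] at this

theorem IsAchievableRate.of_eventually (hρ : IsState ρ) {r : ℝ≥0} {f : ℕ → ℝ}
    (hf : Tendsto f atTop (𝓝 1))
    (h : ∀ᶠ n : ℕ in atTop, ∃ ω : Matrix
      ((Fin ⌊(n : ℝ≥0) * r⌋₊ → Fin 2) × (Fin ⌊(n : ℝ≥0) * r⌋₊ → Fin 2))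
      ((Fin ⌊(n : ℝ≥0) * r⌋₊ → Fin 2) × (Fin ⌊(n : ℝ≥0) * r⌋₊ → Fin 2)) ℂ,
      Converts (tensorPow ρ n) ω ∧ f n ≤ overlap ω) : IsAchievableRate ρ r := by
  have h' : ∀ n : ℕ, ∃ Λ : Matrix ((Fin n → A) × (Fin n → B)) ((Fin n → A) × (Fin n → B)) ℂ →
      Matrix ((Fin ⌊(n : ℝ≥0) * r⌋₊ → Fin 2) × (Fin ⌊(n : ℝ≥0) * r⌋₊ → Fin 2))
        ((Fin ⌊(n : ℝ≥0) * r⌋₊ → Fin 2) × (Fin ⌊(n : ℝ≥0) * r⌋₊ → Fin 2)) ℂ,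
      IsLOCC _ _ (Fin n → A) (Fin n → B) Λ ∧
      ((∃ ω : Matrix ((Fin ⌊(n : ℝ≥0) * r⌋₊ → Fin 2) × (Fin ⌊(n : ℝ≥0) * r⌋₊ → Fin 2))
        ((Fin ⌊(n : ℝ≥0) * r⌋₊ → Fin 2) × (Fin ⌊(n : ℝ≥0) * r⌋₊ → Fin 2)) ℂ,
        Converts (tensorPow ρ n) ω ∧ f n ≤ overlap ω) → f n ≤ overlap (Λ (tensorPow ρ n))) := by
    intro n
    by_cases hn : ∃ ω : Matrix ((Fin ⌊(n : ℝ≥0) * r⌋₊ → Fin 2) × (Fin ⌊(n : ℝ≥0) * r⌋₊ → Fin 2))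
        ((Fin ⌊(n : ℝ≥0) * r⌋₊ → Fin 2) × (Fin ⌊(n : ℝ≥0) * r⌋₊ → Fin 2)) ℂ,
        Converts (tensorPow ρ n) ω ∧ f n ≤ overlap ω
    · obtain ⟨ω, ⟨Λ, hΛ, rfl⟩, hω⟩ := hn
      exact ⟨Λ, hΛ, fun _ => hω⟩
    -- A protocol is required for every `n`; where none is supplied, any LOCC map into the right
    -- system will do.
    · obtain ⟨Λ, hΛ, -⟩ := Converts.of_prepare (tensorPow ρ n)
        (0 : Fin ⌊(n : ℝ≥0) * r⌋₊ → Fin 2) (0 : Fin ⌊(n : ℝ≥0) * r⌋₊ → Fin 2)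
      exact ⟨Λ, hΛ, fun h => absurd h hn⟩
  choose Λ hΛ hov using h'
  refine ⟨Λ, hΛ, ?_⟩
  have hs := fun n => Converts.isState ⟨Λ n, hΛ n, rfl⟩ (isState_tensorPow hρ n)
  have hg : Tendsto (fun n => (1 - f n) / 2 + √(1 - f n)) atTop (𝓝 0) := by
    have h1 : Tendsto (fun n => 1 - f n) atTop (𝓝 0) := by simpa using hf.const_sub 1
    simpa using (h1.div_const 2).add h1.sqrt
  refine squeeze_zero' (Eventually.of_forall fun n => traceDist_nonneg _ _) ?_ hg
  filter_upwards [h] with n hn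
  have h1 := hov n hn
  refine (traceDist_le_of_overlap (hs n)).trans ?_
  gcongr

/-- The projection onto the product of two vectors. -/
def productOp (v : A → ℂ) (w : B → ℂ) : Matrix (A × B) (A × B) ℂ :=
  Matrix.vecMulVec (fun p => v p.1 * w p.2) (star fun p => v p.1 * w p.2)

theorem kronecker_conj_productOp {C D : Type} [Fintype C] [Fintype D] (K : Matrix C A ℂ)
    (L : Matrix D B ℂ) (v : A → ℂ) (w : B → ℂ) :
    (K ⊗ₖ L) * productOp v w * (K ⊗ₖ L)ᴴ = productOp (K *ᵥ v) (L *ᵥ w) := by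
  have h : (K ⊗ₖ L) *ᵥ (fun p => v p.1 * w p.2) = fun p => (K *ᵥ v) p.1 * (L *ᵥ w) p.2 := by
    ext p
    simp only [Matrix.mulVec, dotProduct, Fintype.sum_prod_type, Matrix.kroneckerMap_apply,
      Finset.sum_mul_sum]
    exact Finset.sum_congr rfl fun i _ => Finset.sum_congr rfl fun j _ => by ring
  rw [productOp, Matrix.mul_vecMulVec, Matrix.vecMulVec_mul, ← Matrix.star_mulVec, h]
  rfl

theorem sum_re_star_mulVec_dotProduct {ι C : Type} [Fintype ι] [Fintype C] (K : ι → Matrix C A ℂ)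
    (hK : ∑ i, (K i)ᴴ * K i = 1) (v : A → ℂ) :
    ∑ i, (star (K i *ᵥ v) ⬝ᵥ (K i *ᵥ v)).re = (star v ⬝ᵥ v).re := by
  rw [← Complex.re_sum]
  have : ∀ i, star (K i *ᵥ v) ⬝ᵥ (K i *ᵥ v) = star v ⬝ᵥ ((K i)ᴴ * K i) *ᵥ v := by
    intro i
    rw [Matrix.star_mulVec, ← Matrix.dotProduct_mulVec, Matrix.mulVec_mulVec]
  simp_rw [this]
  rw [← dotProduct_sum, ← Matrix.sum_mulVec, hK, Matrix.one_mulVec]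

/-- The overlap is `2 ^ (-m)` times the squared modulus of `∑ x, v x * w x`, so Cauchy–Schwarz
applies. -/
theorem overlap_productOp_le {m : ℕ} (v w : (Fin m → Fin 2) → ℂ) :
    overlap (productOp v w) ≤ (2 ^ m)⁻¹ * ((star v ⬝ᵥ v).re * (star w ⬝ᵥ w).re) := by
  have hn : ∀ v : (Fin m → Fin 2) → ℂ, (star v ⬝ᵥ v).re = ∑ x, ‖v x‖ ^ 2 := by
    intro v
    simp only [dotProduct, Pi.star_apply, Complex.re_sum]
    refine Finset.sum_congr rfl fun x _ => ?_
    rw [Complex.star_def, ← Complex.normSq_eq_conj_mul_self, Complex.ofReal_re,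
      Complex.normSq_eq_norm_sq]
  set c : ℝ := (Real.sqrt 2)⁻¹ ^ m with hc
  have h2 : c ^ 2 = (2 ^ m)⁻¹ := by
    rw [hc, ← pow_mul, mul_comm, pow_mul, inv_pow, Real.sq_sqrt zero_le_two, inv_pow]
  have e : overlap (productOp v w) = ‖star (singletVec m) ⬝ᵥ fun p => v p.1 * w p.2‖ ^ 2 := by
    rw [overlap, tensorPow_phiPlus, productOp, Matrix.vecMulVec_mul_vecMulVec,
      Matrix.vecMulVec_smul, Matrix.trace_smul, Matrix.trace_vecMulVec, smul_eq_mul]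
    set u : (Fin m → Fin 2) × (Fin m → Fin 2) → ℂ := fun p => v p.1 * w p.2
    have e3 : singletVec m ⬝ᵥ star u = star (star (singletVec m) ⬝ᵥ u) := by
      rw [← Matrix.star_dotProduct_star, star_star, dotProduct_comm]
    rw [e3, Complex.star_def, Complex.mul_conj, Complex.ofReal_re, Complex.normSq_eq_norm_sq]
  have e2 : star (singletVec m) ⬝ᵥ (fun p => v p.1 * w p.2) = (c : ℂ) * ∑ x, v x * w x := by
    simp only [dotProduct, Pi.star_apply, singletVec, Fintype.sum_prod_type, Finset.mul_sum]
    refine Finset.sum_congr rfl fun x _ => ?_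
    simp [apply_ite, ← hc]
  rw [e, e2, norm_mul, mul_pow, Complex.norm_real, Real.norm_eq_abs, sq_abs, h2, hn, hn]
  refine mul_le_mul_of_nonneg_left ?_ (by positivity)
  calc ‖∑ x, v x * w x‖ ^ 2 ≤ (∑ x, ‖v x‖ * ‖w x‖) ^ 2 := by
        gcongr
        exact (norm_sum_le _ _).trans_eq (by simp)
    _ ≤ _ := Finset.sum_mul_sq_le_sq_mul_sq _ _ _

/-- Each Kraus operator maps a product vector to a product vector, and the squared norms over all
outcomes add up to the original one. Thus the bound passes down the protocol tree. -/
theorem IsLOCC.overlap_productOp_le {m : ℕ} {Λ : Matrix (A × B) (A × B) ℂ →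
      Matrix ((Fin m → Fin 2) × (Fin m → Fin 2)) ((Fin m → Fin 2) × (Fin m → Fin 2)) ℂ}
    (h : IsLOCC (Fin m → Fin 2) (Fin m → Fin 2) A B Λ) (v : A → ℂ) (w : B → ℂ) :
    overlap (Λ (productOp v w)) ≤ (2 ^ m)⁻¹ * ((star v ⬝ᵥ v).re * (star w ⬝ᵥ w).re) := by
  induction h with
  | done => exact GeometricDistillability.overlap_productOp_le v w
  | alice K hK Λ hΛ ih =>
    rw [overlap_sum, ← sum_re_star_mulVec_dotProduct K hK, Finset.sum_mul, Finset.mul_sum]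
    refine Finset.sum_le_sum fun i _ => ?_
    rw [kronecker_conj_productOp, Matrix.one_mulVec]
    exact ih i _ _
  | bob K hK Λ hΛ ih =>
    rw [overlap_sum, ← sum_re_star_mulVec_dotProduct K hK, Finset.mul_sum, Finset.mul_sum]
    refine Finset.sum_le_sum fun i _ => ?_
    rw [kronecker_conj_productOp, Matrix.one_mulVec]
    exact ih i _ _

theorem tensorPow_productOp (v : A → ℂ) (w : B → ℂ) (n : ℕ) :
    tensorPow (productOp v w) n = productOp (fun x => ∏ i, v (x i)) (fun y => ∏ i, w (y i)) := by
  ext p q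
  simp [tensorPow, productOp, Matrix.vecMulVec_apply, Finset.prod_mul_distrib]

theorem re_trace_productOp (v : A → ℂ) (w : B → ℂ) :
    (productOp v w).trace.re = (star v ⬝ᵥ v).re * (star w ⬝ᵥ w).re := by
  have h : (productOp v w).trace = (star v ⬝ᵥ v) * (star w ⬝ᵥ w) := by
    simp only [productOp, Matrix.trace_vecMulVec, dotProduct, Fintype.sum_prod_type,
      Finset.sum_mul_sum, Pi.star_apply, star_mul']
    exact Finset.sum_congr rfl fun i _ => Finset.sum_congr rfl fun j _ => by ring
  have hv := (Complex.nonneg_iff.mp (dotProduct_star_self_nonneg v)).2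
  rw [h, Complex.mul_re, ← hv, zero_mul, sub_zero]

/-- Local basis states are nondistillable, since their overlap with at least one singlet never
exceeds `1 / 2`. This is needed because the supremum and infimum over an empty set would take the
default value `0`. -/
theorem exists_nondistillable [Nonempty A] [Nonempty B] : (nondistillableStates A B).Nonempty := by
  obtain ⟨a⟩ := ‹Nonempty A›
  obtain ⟨b⟩ := ‹Nonempty B›
  have hn : ∀ {S : Type} [Fintype S] [DecidableEq S] (a : S),
      star (Pi.single a (1 : ℂ) : S → ℂ) ⬝ᵥ Pi.single a 1 = 1 := by
    intro S _ _ a; simp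
  have hs : IsState (productOp (Pi.single a (1 : ℂ)) (Pi.single b (1 : ℂ))) := by
    refine ⟨Matrix.posSemidef_vecMulVec_self_star _, ?_⟩
    rw [productOp, Matrix.trace_vecMulVec]
    simp [dotProduct, Fintype.sum_prod_type, Pi.single_apply, apply_ite]
  refine ⟨_, hs, fun hd => ?_⟩
  obtain ⟨r, hr, h⟩ := isDistillable_iff.mp hd
  obtain ⟨Λ, hΛ, hT⟩ := h.exists_converts hs
  have hbound : ∀ᶠ n : ℕ in atTop, overlap (Λ n (tensorPow
      (productOp (Pi.single a (1 : ℂ)) (Pi.single b (1 : ℂ))) n)) ≤ 1 / 2 := by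
    obtain ⟨n₀, hn₀⟩ := exists_nat_ge (1 / r)
    filter_upwards [eventually_ge_atTop n₀] with n hn
    have hm : 1 ≤ ⌊(n : ℝ≥0) * r⌋₊ := by
      refine Nat.le_floor ?_
      rw [Nat.cast_one]
      calc (1 : ℝ≥0) = 1 / r * r := by field_simp
        _ ≤ n * r := by gcongr; exact hn₀.trans (by exact_mod_cast hn)
    have h1 := (isState_tensorPow hs n).2
    rw [tensorPow_productOp] at h1 ⊢
    refine ((hΛ n).overlap_productOp_le _ _).trans ?_
    rw [← re_trace_productOp, h1, Complex.one_re, mul_one, one_div]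
    gcongr
    exact le_self_pow₀ one_le_two (by omega)
  have := le_of_tendsto hT hbound
  norm_num at this

end Distillation

/-! ### Characters and parity checks over `ℤ/2` -/

section Bits

open scoped ComplexOrder Fin.CommRing

/-- The nontrivial character of `ℤ/2`. -/
def bitSign (u : Fin 2) : ℝ := if u = 0 then 1 else -1

@[simp] theorem bitSign_zero : bitSign 0 = 1 := rfl

theorem bitSign_add (u v : Fin 2) : bitSign (u + v) = bitSign u * bitSign v := by
  fin_cases u <;> fin_cases v <;> simp [bitSign]

theorem bitSign_mul_self (u : Fin 2) : bitSign u * bitSign u = 1 := by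
  fin_cases u <;> simp [bitSign]

theorem bitSign_sum {ι : Type} (s : Finset ι) (f : ι → Fin 2) :
    bitSign (∑ i ∈ s, f i) = ∏ i ∈ s, bitSign (f i) := by
  classical
  induction s using Finset.induction_on with
  | empty => simp
  | insert i s hi ih => rw [Finset.sum_insert hi, Finset.prod_insert hi, bitSign_add, ih]

theorem sum_bitSign_mul (v : Fin 2) : ∑ β : Fin 2, bitSign (β * v) = if v = 0 then 2 else 0 := by
  fin_cases v <;> simp [bitSign]

theorem bit_add_self (u : Fin 2) : u + u = 0 := by
  fin_cases u <;> rfl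

variable {n : ℕ}

theorem bits_add_self (x : Fin n → Fin 2) : x + x = 0 := funext fun i => bit_add_self (x i)

theorem bits_add_eq_zero {x y : Fin n → Fin 2} : x + y = 0 ↔ x = y := by
  constructor
  · intro h
    have := congrArg (· + y) h
    simpa [add_assoc, bits_add_self] using this
  · rintro rfl
    exact bits_add_self x

/-- Character orthogonality: the sum factors over the coordinates, and a coordinate with `u i ≠ 0`
contributes the factor `1 - 1`. -/
theorem sum_bitSign_dotProduct (u : Fin n → Fin 2) :
    ∑ x : Fin n → Fin 2, bitSign (x ⬝ᵥ u) = if u = 0 then 2 ^ n else 0 := by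
  simp only [dotProduct, bitSign_sum]
  have h := Finset.prod_univ_sum (fun _ : Fin n => (Finset.univ : Finset (Fin 2)))
    (fun i t => bitSign (t * u i))
  rw [Fintype.piFinset_univ] at h
  rw [← h]
  simp only [sum_bitSign_mul]
  by_cases hu : u = 0
  · simp [hu]
  · obtain ⟨i, hi⟩ := Function.ne_iff.mp hu
    rw [if_neg hu, Finset.prod_eq_zero (Finset.mem_univ i)]
    exact if_neg hi

/-- Some parity check detects at least half of the weight of all nonzero strings. -/
theorem exists_parity_check (w : (Fin (n + 1) → Fin 2) → ℝ) (hw : ∀ a, 0 ≤ w a) :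
    ∃ h : Fin (n + 1) → Fin 2, h ≠ 0 ∧
      2 * ∑ a with a ≠ 0 ∧ h ⬝ᵥ a = 0, w a ≤ ∑ a with a ≠ 0, w a := by
  classical
  set g : (Fin (n + 1) → Fin 2) → ℝ := fun h => ∑ a with a ≠ 0, w a * bitSign (h ⬝ᵥ a) with hg
  -- Over all `h` the signed weights cancel, while `h = 0` contributes the nonnegative total; hence
  -- some nonzero `h` has `g h ≤ 0`. Having `n + 1` bits guarantees that a nonzero `h` exists.
  have hsum : ∑ h, g h = 0 := by
    rw [hg, Finset.sum_comm]
    refine Finset.sum_eq_zero fun a ha => ?_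
    rw [← Finset.mul_sum, sum_bitSign_dotProduct, if_neg (Finset.mem_filter.mp ha).2, mul_zero]
  have hg0 : 0 ≤ g 0 := Finset.sum_nonneg fun a _ => by simpa using hw a
  obtain ⟨h, hh, hgh⟩ : ∃ h ≠ 0, g h ≤ 0 := by
    by_contra! hcon
    have h1 : (1 : Fin (n + 1) → Fin 2) ≠ 0 := fun h => by simpa using congrFun h 0
    have : 0 < ∑ h, g h := Finset.sum_pos' (fun h _ => by
      by_cases h0 : h = 0
      · rwa [h0]
      · exact (hcon h h0).le) ⟨1, Finset.mem_univ _, hcon 1 h1⟩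
    linarith
  refine ⟨h, hh, ?_⟩
  have : g h = 2 * ∑ a with a ≠ 0 ∧ h ⬝ᵥ a = 0, w a - ∑ a with a ≠ 0, w a := by
    rw [← Finset.filter_filter, Finset.sum_filter (fun a => h ⬝ᵥ a = 0), Finset.mul_sum,
      ← Finset.sum_sub_distrib]
    refine Finset.sum_congr rfl fun a _ => ?_
    unfold bitSign
    split_ifs <;> ring
  linarith

/-- A nonzero parity check is the first coordinate of an invertible linear change of variables
`e`, with contragredient `d`. -/
theorem exists_parity_equiv {h : Fin (n + 1) → Fin 2} (hh : h ≠ 0) :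
    ∃ e d : (Fin (n + 1) → Fin 2) ≃+ Fin 2 × (Fin n → Fin 2), (∀ x, (e x).1 = h ⬝ᵥ x) ∧
      ∀ b x, b ⬝ᵥ x = (d b).1 * (e x).1 + (d b).2 ⬝ᵥ (e x).2 := by
  obtain ⟨i, hi⟩ := Function.ne_iff.mp hh
  have hi1 : h i = 1 := by
    revert hi
    generalize h i = t
    fin_cases t <;> simp
  -- `e` replaces the coordinate `x i` by the parity `h ⬝ᵥ x`, which is invertible as `h i = 1`. Its
  -- inverse transpose `d` keeps `b i` and adds `b i * h j` to every other coordinate `j`.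
  refine ⟨⟨⟨fun x => (h ⬝ᵥ x, i.removeNth x),
      fun p => i.insertNth (p.1 + ∑ j, h (i.succAbove j) * p.2 j) p.2, ?_, ?_⟩, ?_⟩,
    ⟨⟨fun b => (b i, fun j => b (i.succAbove j) + b i * h (i.succAbove j)),
      fun p => i.insertNth p.1 (fun j => p.2 j + p.1 * h (i.succAbove j)), ?_, ?_⟩, ?_⟩,
    fun x => rfl, ?_⟩
  · intro x
    refine funext fun j => ?_
    refine Fin.succAboveCases i ?_ (fun j => ?_) j
    · simp only [dotProduct, Fin.sum_univ_succAbove _ i, Fin.insertNth_apply_same, Fin.removeNth,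
        hi1, one_mul, add_assoc, bit_add_self, add_zero]
    · simp [Fin.removeNth]
  · intro p
    refine Prod.ext ?_ ?_
    · simp only [dotProduct, Fin.sum_univ_succAbove _ i, Fin.insertNth_apply_same,
        Fin.insertNth_apply_succAbove, hi1, one_mul, add_assoc, bit_add_self, add_zero]
    · simp
  · intro x y
    exact Prod.ext (dotProduct_add h x y) rfl
  · intro x
    refine funext fun j => ?_
    refine Fin.succAboveCases i ?_ (fun j => ?_) j
    · simp
    · simp [add_assoc, bit_add_self]
  · intro p
    refine Prod.ext ?_ (funext fun j => ?_)
    · simp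
    · simp [add_assoc, bit_add_self]
  · intro x y
    refine Prod.ext rfl (funext fun j => ?_)
    simp only [Pi.add_apply, Prod.mk_add_mk]
    ring
  · intro b x
    have hz : ∀ t : Fin 2, 2 * t = 0 := fun t => by rw [two_mul, bit_add_self]
    simp only [AddEquiv.coe_mk, Equiv.coe_fn_mk, dotProduct, Fin.sum_univ_succAbove _ i, hi1,
      Fin.removeNth, add_mul, Finset.sum_add_distrib, mul_add, Finset.mul_sum, one_mul]
    have : ∀ s t u : Fin 2, s + t = s + u + (t + u) := by decide
    rw [this (b i * x i) _ (∑ j, b i * (h (i.succAbove j) * x (i.succAbove j)))]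
    simp only [mul_assoc]

end Bits

/-! ### The Bell basis: weights, parity measurements, Hadamard transform, Pauli corrections -/

section Bell

open scoped ComplexOrder Fin.CommRing

variable {n : ℕ}

/-- The Bell vector with bit error `a` and phase error `b`. -/
noncomputable def bellVec (a b : Fin n → Fin 2) : (Fin n → Fin 2) × (Fin n → Fin 2) → ℂ :=
  fun p => if p.2 = p.1 + a then (((Real.sqrt 2)⁻¹ ^ n * bitSign (b ⬝ᵥ p.1) : ℝ) : ℂ) else 0

/-- The weight of an operator on a Bell vector. -/
noncomputable def bellWeight (ρ : Matrix ((Fin n → Fin 2) × (Fin n → Fin 2))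
    ((Fin n → Fin 2) × (Fin n → Fin 2)) ℂ) (a b : Fin n → Fin 2) : ℂ :=
  star (bellVec a b) ⬝ᵥ ρ *ᵥ bellVec a b

variable {ρ : Matrix ((Fin n → Fin 2) × (Fin n → Fin 2)) ((Fin n → Fin 2) × (Fin n → Fin 2)) ℂ}

theorem inv_sqrt_two_pow_sq (n : ℕ) :
    ((Real.sqrt 2)⁻¹ ^ n * (Real.sqrt 2)⁻¹ ^ n : ℝ) = (2 ^ n)⁻¹ := by
  rw [← mul_pow, ← mul_inv, Real.mul_self_sqrt zero_le_two, inv_pow]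

theorem overlap_eq_bellWeight : overlap ρ = (bellWeight ρ 0 0).re := by
  have : singletVec n = bellVec 0 0 := by
    ext p
    simp [singletVec, bellVec, eq_comm]
  rw [overlap, tensorPow_phiPlus, trace_vecMulVec_mul, bellWeight, this]

theorem bellWeight_nonneg (hρ : ρ.PosSemidef) (a b : Fin n → Fin 2) : 0 ≤ (bellWeight ρ a b).re :=
  (Complex.nonneg_iff.mp (hρ.dotProduct_mulVec_nonneg _)).1

theorem bellWeight_conj (K : Matrix ((Fin n → Fin 2) × (Fin n → Fin 2))
    ((Fin n → Fin 2) × (Fin n → Fin 2)) ℂ) (a b : Fin n → Fin 2) :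
    bellWeight (K * ρ * Kᴴ) a b = star (Kᴴ *ᵥ bellVec a b) ⬝ᵥ ρ *ᵥ (Kᴴ *ᵥ bellVec a b) := by
  rw [bellWeight, ← Matrix.mulVec_mulVec, ← Matrix.mulVec_mulVec, Matrix.star_mulVec,
    Matrix.conjTranspose_conjTranspose, ← Matrix.dotProduct_mulVec]

theorem bellWeight_eq (a b : Fin n → Fin 2) : bellWeight ρ a b =
    ((2 ^ n)⁻¹ : ℝ) * ∑ x, ∑ x', (bitSign (b ⬝ᵥ (x + x')) : ℂ) * ρ (x, x + a) (x', x' + a) := by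
  simp only [bellWeight, dotProduct, Matrix.mulVec, Fintype.sum_prod_type, Pi.star_apply, bellVec,
    apply_ite star, star_zero, ite_mul, zero_mul, mul_ite, mul_zero, Finset.sum_ite_eq',
    Finset.mem_univ, if_true]
  rw [Finset.mul_sum]
  refine Finset.sum_congr rfl fun x _ => ?_
  rw [Finset.mul_sum, Finset.mul_sum]
  refine Finset.sum_congr rfl fun x' _ => ?_
  have : ∑ i, b i * (x + x') i = ∑ i, b i * x i + ∑ i, b i * x' i := by
    rw [← Finset.sum_add_distrib]
    exact Finset.sum_congr rfl fun i _ => mul_add _ _ _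
  rw [this, bitSign_add, ← inv_sqrt_two_pow_sq, Complex.star_def, Complex.conj_ofReal]
  push_cast
  ring

/-- Summing over the phase error `b` kills all terms with `x ≠ x'`; summing over `a` then collects
the diagonal entries. -/
theorem sum_bellWeight : ∑ a, ∑ b, bellWeight ρ a b = ρ.trace := by
  simp only [bellWeight_eq, ← Finset.mul_sum]
  have h : ∀ a : Fin n → Fin 2, ∑ b : Fin n → Fin 2, ∑ x, ∑ x',
      (bitSign (b ⬝ᵥ (x + x')) : ℂ) * ρ (x, x + a) (x', x' + a) =
      (2 ^ n : ℝ) * ∑ x, ρ (x, x + a) (x, x + a) := by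
    intro a
    rw [Finset.sum_comm, Finset.mul_sum]
    refine Finset.sum_congr rfl fun x _ => ?_
    rw [Finset.sum_comm]
    simp only [← Finset.sum_mul, ← Complex.ofReal_sum, sum_bitSign_dotProduct, bits_add_eq_zero]
    rw [Finset.sum_eq_single x]
    · simp
    · intro y _ hy
      rw [if_neg (Ne.symm hy)]
      simp
    · simp
  simp only [h, ← Finset.mul_sum]
  rw [← mul_assoc, ← Complex.ofReal_mul, inv_mul_cancel₀ (by positivity), Complex.ofReal_one,
    one_mul, Finset.sum_comm, Matrix.trace, Fintype.sum_prod_type]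
  refine Finset.sum_congr rfl fun x _ => ?_
  exact Equiv.sum_comp (Equiv.addLeft x) (fun y => ρ (x, y) (x, y))

/-- How the Bell weights change when both parties measure the same parity check. -/
theorem sum_bellWeight_block
    {ρ : Matrix ((Fin (n + 1) → Fin 2) × (Fin (n + 1) → Fin 2))
      ((Fin (n + 1) → Fin 2) × (Fin (n + 1) → Fin 2)) ℂ}
    {e d : (Fin (n + 1) → Fin 2) ≃+ Fin 2 × (Fin n → Fin 2)}
    (hed : ∀ b x, b ⬝ᵥ x = (d b).1 * (e x).1 + (d b).2 ⬝ᵥ (e x).2) (u : Fin 2)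
    (a b : Fin n → Fin 2) :
    ∑ s, bellWeight (block e.toEquiv e.toEquiv ρ s (s + u)) a b =
      ∑ β, bellWeight ρ (e.symm (u, a)) (d.symm (β, b)) := by
  simp only [bellWeight_eq, ← Finset.mul_sum]
  have h1 : ∀ s (y : Fin n → Fin 2), e.symm (s + u, y + a) = e.symm (s, y) + e.symm (u, a) := by
    intro s y
    rw [← map_add]; rfl
  have h2 : ∀ β x, d.symm (β, b) ⬝ᵥ x = β * (e x).1 + b ⬝ᵥ (e x).2 := by
    intro β x
    rw [hed]; simp
  -- Summing over the phase bit `β` conjugate to the measured parity removes the coherences between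
  -- different parities, exactly as the measurement does.
  have h3 : ∑ β, ∑ x, ∑ x', (bitSign (d.symm (β, b) ⬝ᵥ (x + x')) : ℂ) *
      ρ (x, x + e.symm (u, a)) (x', x' + e.symm (u, a)) =
      (2 : ℝ) * ∑ s, ∑ y, ∑ y', (bitSign (b ⬝ᵥ (y + y')) : ℂ) *
        ρ (e.symm (s, y), e.symm (s, y) + e.symm (u, a))
          (e.symm (s, y'), e.symm (s, y') + e.symm (u, a)) := by
    rw [Finset.sum_comm, ← e.symm.toEquiv.sum_comp, Fintype.sum_prod_type, Finset.mul_sum]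
    refine Finset.sum_congr rfl fun s _ => ?_
    rw [Finset.mul_sum]
    refine Finset.sum_congr rfl fun y _ => ?_
    rw [Finset.sum_comm, ← e.symm.toEquiv.sum_comp, Fintype.sum_prod_type, Finset.mul_sum,
      Finset.sum_comm]
    refine Finset.sum_congr rfl fun y' _ => ?_
    have h4 : ∀ s' β, (bitSign (d.symm (β, b) ⬝ᵥ (e.symm (s, y) + e.symm (s', y'))) : ℂ) =
        (bitSign (β * (s + s')) : ℂ) * (bitSign (b ⬝ᵥ (y + y')) : ℂ) := by
      intro s' β
      rw [h2, map_add, AddEquiv.apply_symm_apply, AddEquiv.apply_symm_apply, bitSign_add]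
      push_cast
      rfl
    simp only [AddEquiv.toEquiv_eq_coe, EquivLike.coe_coe, h4]
    simp only [← Finset.sum_mul, ← Complex.ofReal_sum, sum_bitSign_mul]
    rw [Finset.sum_eq_single s]
    · simp [bit_add_self]; ring
    · intro t _ ht
      rw [if_neg]
      · simp
      · have : ∀ s t : Fin 2, t ≠ s → ¬ s + t = 0 := by decide
        exact this s t ht
    · simp
  rw [h3, ← mul_assoc, ← Complex.ofReal_mul]
  congr 1
  · congr 1
    rw [pow_succ]
    field_simp
  · refine Finset.sum_congr rfl fun s _ => Finset.sum_congr rfl fun y _ =>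
      Finset.sum_congr rfl fun y' _ => ?_
    rw [← h1, ← h1]
    rfl

/-- The Hadamard transform. -/
noncomputable def hadamard (n : ℕ) : Matrix (Fin n → Fin 2) (Fin n → Fin 2) ℂ :=
  fun x y => (((Real.sqrt 2)⁻¹ ^ n * bitSign (x ⬝ᵥ y) : ℝ) : ℂ)

theorem hadamard_conjTranspose : (hadamard n)ᴴ = hadamard n := by
  ext x y
  rw [Matrix.conjTranspose_apply, hadamard, Complex.star_def, Complex.conj_ofReal, hadamard,
    dotProduct_comm]

theorem hadamard_mul_self : hadamard n * hadamard n = 1 := by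
  ext x y
  have h : ∀ z, (hadamard n x z * hadamard n z y : ℂ) =
      (((2 ^ n)⁻¹ * bitSign (z ⬝ᵥ (x + y)) : ℝ) : ℂ) := by
    intro z
    rw [hadamard, hadamard, ← Complex.ofReal_mul, dotProduct_add, bitSign_add, dotProduct_comm x z,
      ← inv_sqrt_two_pow_sq]
    congr 1
    ring
  simp only [Matrix.mul_apply, h]
  rw [← Complex.ofReal_sum, ← Finset.mul_sum, sum_bitSign_dotProduct, Matrix.one_apply]
  simp only [bits_add_eq_zero]
  split_ifs <;> simp

/-- The Hadamard transform on both sides exchanges the two labels of a Bell vector up to a global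
sign, which cancels in the weight. -/
theorem bellWeight_hadamard (a b : Fin n → Fin 2) :
    bellWeight ((hadamard n ⊗ₖ hadamard n) * ρ * (hadamard n ⊗ₖ hadamard n)ᴴ) a b =
      bellWeight ρ b a := by
  have h : (hadamard n ⊗ₖ hadamard n)ᴴ *ᵥ bellVec a b =
      (bitSign (a ⬝ᵥ b) : ℂ) • bellVec b a := by
    rw [Matrix.conjTranspose_kronecker, hadamard_conjTranspose]
    ext p
    simp only [Matrix.mulVec, dotProduct, Fintype.sum_prod_type, Matrix.kroneckerMap_apply, bellVec,
      mul_ite, mul_zero, Finset.sum_ite_eq', Finset.mem_univ, if_true,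
      Pi.smul_apply, smul_eq_mul]
    simp only [hadamard, ← Complex.ofReal_mul]
    have e : ∀ x : Fin n → Fin 2, (Real.sqrt 2)⁻¹ ^ n * bitSign (p.1 ⬝ᵥ x) *
        ((Real.sqrt 2)⁻¹ ^ n * bitSign (p.2 ⬝ᵥ (x + a))) *
        ((Real.sqrt 2)⁻¹ ^ n * bitSign (b ⬝ᵥ x)) =
        (2 ^ n)⁻¹ * ((Real.sqrt 2)⁻¹ ^ n * bitSign (a ⬝ᵥ p.2)) *
          bitSign (x ⬝ᵥ (p.2 + (p.1 + b))) := by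
      intro x
      rw [← inv_sqrt_two_pow_sq, dotProduct_add, dotProduct_add, dotProduct_add, bitSign_add,
        bitSign_add, bitSign_add, dotProduct_comm x p.1, dotProduct_comm x p.2, dotProduct_comm x b,
        dotProduct_comm a p.2]
      ring
    have e' : ∀ x : Fin n → Fin 2, ∑ i, b i * x i = b ⬝ᵥ x := fun _ => rfl
    simp only [e', e]
    rw [← Complex.ofReal_sum, ← Finset.mul_sum, sum_bitSign_dotProduct]
    simp only [bits_add_eq_zero]
    split_ifs with hp
    · rw [hp, dotProduct_add, bitSign_add]
      congr 1
      change _ = bitSign (a ⬝ᵥ b) * ((Real.sqrt 2)⁻¹ ^ n * bitSign (a ⬝ᵥ p.1))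
      field_simp
    · simp
  rw [bellWeight_conj, h, Matrix.mulVec_smul, star_smul, smul_dotProduct, dotProduct_smul,
    smul_smul, Complex.star_def, Complex.conj_ofReal, ← Complex.ofReal_mul, bitSign_mul_self]
  simp [bellWeight]

/-- A sign change by Alice and a bit shift by Bob rotate any prescribed Bell vector to the singlets.
-/
theorem exists_pauli_correction (ρ : Matrix ((Fin n → Fin 2) × (Fin n → Fin 2))
    ((Fin n → Fin 2) × (Fin n → Fin 2)) ℂ) (a b : Fin n → Fin 2) :
    ∃ ω : Matrix ((Fin n → Fin 2) × (Fin n → Fin 2)) ((Fin n → Fin 2) × (Fin n → Fin 2)) ℂ,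
      Converts ρ ω ∧ overlap ω = (bellWeight ρ a b).re := by
  set K : Matrix (Fin n → Fin 2) (Fin n → Fin 2) ℂ :=
    Matrix.diagonal fun x => (bitSign (b ⬝ᵥ x) : ℂ) with hK
  set L : Matrix (Fin n → Fin 2) (Fin n → Fin 2) ℂ :=
    (1 : Matrix (Fin n → Fin 2) (Fin n → Fin 2) ℂ).submatrix id (Equiv.addRight a) with hL
  have hKs : Kᴴ = K := by
    rw [hK, Matrix.diagonal_conjTranspose]
    congr 1
    ext x
    simp
  have hK1 : Kᴴ * K = 1 := by
    rw [hKs, hK, Matrix.diagonal_mul_diagonal]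
    simp_rw [← Complex.ofReal_mul, bitSign_mul_self]
    simp
  have hL1 : Lᴴ * L = 1 := by
    rw [hL, Matrix.conjTranspose_submatrix, Matrix.conjTranspose_one,
      ← Matrix.submatrix_mul _ _ _ _ _ Function.bijective_id, Matrix.mul_one,
      Matrix.submatrix_one_equiv]
  refine ⟨_, Converts.of_isometry ρ K hK1 L hL1, ?_⟩
  rw [overlap_eq_bellWeight, bellWeight_conj]
  have h : (K ⊗ₖ L)ᴴ *ᵥ bellVec 0 0 = bellVec a b := by
    rw [Matrix.conjTranspose_kronecker, hKs]
    ext p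
    have h5 : p.1 = p.2 + a ↔ p.2 = p.1 + a := by
      rw [← bits_add_eq_zero, ← @bits_add_eq_zero _ p.2]
      refine iff_of_eq (congrArg (· = 0) ?_)
      abel
    have hLs : ∀ y, Lᴴ p.2 y = if y = p.2 + a then 1 else 0 := by
      intro y
      simp [hL, Matrix.one_apply, apply_ite]
    have hKp : ∀ x, K p.1 x = if p.1 = x then (bitSign (b ⬝ᵥ p.1) : ℂ) else 0 := by
      intro x
      simp [hK, Matrix.diagonal_apply]
    simp only [Matrix.mulVec, dotProduct, Fintype.sum_prod_type, Matrix.kroneckerMap_apply, bellVec,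
      hLs, hKp, ite_mul, mul_ite, mul_one, mul_zero, zero_mul,
      Finset.sum_ite_eq', Finset.mem_univ, if_true, add_zero, h5]
    simp [mul_comm]
  rw [h, bellWeight]

end Bell

/-! ### Error correction by parity checks -/

section Hashing

open scoped ComplexOrder Fin.CommRing

/-- A set `E` of errors on `n` pairs of qubits is `k`-correctable if there are LOCC protocols that
convert the total weight on the Bell vectors of `E` into overlap with `k` singlets. -/
def Correctable (k : ℕ) {n : ℕ} (E : Finset ((Fin n → Fin 2) × (Fin n → Fin 2))) : Prop :=
  ∀ ρ : Matrix ((Fin n → Fin 2) × (Fin n → Fin 2)) ((Fin n → Fin 2) × (Fin n → Fin 2)) ℂ,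
    ρ.PosSemidef → ∃ ω : Matrix ((Fin k → Fin 2) × (Fin k → Fin 2))
      ((Fin k → Fin 2) × (Fin k → Fin 2)) ℂ,
      Converts ρ ω ∧ ∑ e ∈ E, (bellWeight ρ e.1 e.2).re ≤ overlap ω

variable {k n : ℕ}

theorem correctable_of_subsingleton (E : Finset ((Fin n → Fin 2) × (Fin n → Fin 2)))
    (hE : ∀ x ∈ E, ∀ y ∈ E, x = y) : Correctable n E := by
  intro ρ hρ
  rcases E.eq_empty_or_nonempty with rfl | ⟨x, hx⟩
  · exact ⟨ρ, .refl ρ, by simpa using overlap_nonneg hρ⟩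
  · obtain ⟨ω, h, hω⟩ := exists_pauli_correction ρ x.1 x.2
    refine ⟨ω, h, ?_⟩
    have : E = {x} := Finset.eq_singleton_iff_unique_mem.mpr ⟨hx, fun y hy => hE y hy x hx⟩
    rw [this, Finset.sum_singleton, hω]

/-- Local Hadamard transforms make the phase errors accessible to the same parity checks as the bit
errors. -/
theorem Correctable.of_swap {E : Finset ((Fin n → Fin 2) × (Fin n → Fin 2))}
    (h : Correctable k (E.image Prod.swap)) : Correctable k E := by
  intro ρ hρ
  have hH : (hadamard n)ᴴ * hadamard n = 1 := by rw [hadamard_conjTranspose, hadamard_mul_self]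
  obtain ⟨ω, hω, hle⟩ := h _ (hρ.mul_mul_conjTranspose_same (hadamard n ⊗ₖ hadamard n))
  refine ⟨ω, (Converts.of_isometry ρ _ hH _ hH).trans hω, le_trans (le_of_eq ?_) hle⟩
  rw [Finset.sum_image Prod.swap_injective.injOn]
  simp [bellWeight_hadamard]

/-- The parties compare a parity measured on both sides. The sum `u` of the outcomes is the syndrome
of the bit error, and each syndrome may be followed by its own protocol. The phase bit conjugate to
the measured parity becomes irrelevant, which is why the images forget `(d x.2).1`. -/
theorem Correctable.of_parity_check
    {E : Finset ((Fin (n + 1) → Fin 2) × (Fin (n + 1) → Fin 2))}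
    {e d : (Fin (n + 1) → Fin 2) ≃+ Fin 2 × (Fin n → Fin 2)}
    (hed : ∀ b x, b ⬝ᵥ x = (d b).1 * (e x).1 + (d b).2 ⬝ᵥ (e x).2)
    (h : ∀ u, Correctable k
      ({x ∈ E | (e x.1).1 = u}.image fun x => ((e x.1).2, (d x.2).2))) : Correctable k E := by
  intro ρ hρ
  have hb := fun s t => block_posSemidef e.toEquiv e.toEquiv hρ s t
  choose ω hω hle using fun s t => h (s + t) (block e.toEquiv e.toEquiv ρ s t) (hb s t)
  refine ⟨_, Converts.of_block e.toEquiv e.toEquiv ρ ω hω, ?_⟩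
  set f : (Fin (n + 1) → Fin 2) × (Fin (n + 1) → Fin 2) → ℝ :=
    fun x => (bellWeight ρ x.1 x.2).re with hf
  have hf0 : ∀ x, 0 ≤ f x := fun x => bellWeight_nonneg hρ _ _
  have h1 : ∑ x ∈ E, f x = ∑ u, ∑ x ∈ E with (e x.1).1 = u, f x :=
    (Finset.sum_fiberwise E (fun x => (e x.1).1) f).symm
  have h2 : ∀ u, ∑ x ∈ E with (e x.1).1 = u, f x ≤
      ∑ y ∈ {x ∈ E | (e x.1).1 = u}.image fun x => ((e x.1).2, (d x.2).2),
        ∑ β, f (e.symm (u, y.1), d.symm (β, y.2)) := by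
    intro u
    rw [← Finset.sum_product']
    set φ : (Fin (n + 1) → Fin 2) × (Fin (n + 1) → Fin 2) →
      ((Fin n → Fin 2) × (Fin n → Fin 2)) × Fin 2 :=
      fun x => (((e x.1).2, (d x.2).2), (d x.2).1) with hφ
    set F : ((Fin n → Fin 2) × (Fin n → Fin 2)) × Fin 2 → ℝ :=
      fun y => f (e.symm (u, y.1.1), d.symm (y.2, y.1.2)) with hF
    have hFφ : ∀ x ∈ {x ∈ E | (e x.1).1 = u}, f x = F (φ x) := by
      intro x hx
      have hu := (Finset.mem_filter.mp hx).2
      change f x = f (e.symm (u, (e x.1).2), d.symm (d x.2))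
      rw [← hu]
      simp
    -- At a fixed syndrome, the reduced error and the forgotten phase bit determine the error, so no
    -- weight is counted twice.
    have hinj : Set.InjOn φ ({x ∈ E | (e x.1).1 = u} : Finset _) := by
      intro x hx y hy hxy
      have hx' := (Finset.mem_filter.mp hx).2
      have hy' := (Finset.mem_filter.mp hy).2
      simp only [hφ, Prod.mk.injEq] at hxy
      exact Prod.ext (e.injective (Prod.ext (hx'.trans hy'.symm) hxy.1.1))
        (d.injective (Prod.ext hxy.2 hxy.1.2))
    rw [Finset.sum_congr rfl hFφ, ← Finset.sum_image hinj]
    refine Finset.sum_le_sum_of_subset_of_nonneg ?_ fun _ _ _ => hf0 _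
    intro y hy
    obtain ⟨x, hx, rfl⟩ := Finset.mem_image.mp hy
    exact Finset.mem_product.mpr ⟨Finset.mem_image_of_mem _ hx, Finset.mem_univ _⟩
  have h3 : ∀ u (y : (Fin n → Fin 2) × (Fin n → Fin 2)),
      ∑ β, f (e.symm (u, y.1), d.symm (β, y.2)) =
      ∑ s, (bellWeight (block e.toEquiv e.toEquiv ρ s (s + u)) y.1 y.2).re := by
    intro u y
    rw [← Complex.re_sum, ← Complex.re_sum, sum_bellWeight_block hed]
  calc ∑ x ∈ E, f x ≤ ∑ u, ∑ s, overlap (ω s (s + u)) := by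
        rw [h1]
        refine Finset.sum_le_sum fun u _ => (h2 u).trans ?_
        simp only [h3]
        rw [Finset.sum_comm]
        refine Finset.sum_le_sum fun s _ => ?_
        have := hle s (s + u)
        rwa [← add_assoc, bit_add_self, zero_add] at this
    _ = overlap (∑ s, ∑ t, ω s t) := by
        rw [overlap_sum, Finset.sum_comm]
        refine Finset.sum_congr rfl fun s _ => ?_
        rw [overlap_sum]
        exact Equiv.sum_comp (Equiv.addLeft s) fun t => overlap (ω s t)

/-- Enough parity checks identify the bit error. -/
theorem Correctable.of_parity_checks {k' : ℕ} (R : Prop) (M : ℕ)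
    (H : ∀ E : Finset ((Fin k' → Fin 2) × (Fin k' → Fin 2)), E.card ≤ M →
      (∀ x ∈ E, ∀ y ∈ E, x.1 = y.1) → (R → ∀ x ∈ E, ∀ y ∈ E, x.2 = y.2) → Correctable k E)
    (c : ℕ) (T : Finset (Fin (k' + c) → Fin 2)) (hT0 : 0 ∉ T) (hT : T.card < 2 ^ c)
    (E : Finset ((Fin (k' + c) → Fin 2) × (Fin (k' + c) → Fin 2)))
    (hET : ∀ x ∈ E, ∀ y ∈ E, x.1 ≠ y.1 → x.1 + y.1 ∈ T) (hEM : E.card ≤ M)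
    (hER : R → ∀ x ∈ E, ∀ y ∈ E, x.2 = y.2) : Correctable k E := by
  induction c with
  | zero =>
    have : T = ∅ := by simpa using hT
    subst this
    refine H E hEM (fun x hx y hy => ?_) hER
    by_contra h
    exact absurd (hET x hx y hy h) (Finset.notMem_empty _)
  | succ c ih =>
    -- `T` contains the differences of bit errors still to be told apart. With indicator weights,
    -- the chosen check leaves at most half of `T` undetected; after `c` checks fewer than one
    -- element remains.
    obtain ⟨h, hh, hle⟩ := exists_parity_check (n := k' + c) (fun a => if a ∈ T then 1 else 0)
      fun a => by split_ifs <;> norm_num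
    obtain ⟨e, d, he, hed⟩ := exists_parity_equiv hh
    have hcard : 2 * ({t ∈ T | (e t).1 = 0}).card ≤ T.card := by
      rw [Finset.sum_ite_mem, Finset.sum_ite_mem, Finset.sum_const, Finset.sum_const, nsmul_one,
        nsmul_one] at hle
      have e1 : ({t ∈ T | (e t).1 = 0}) =
          ({a | a ≠ 0 ∧ h ⬝ᵥ a = 0} : Finset (Fin (k' + c + 1) → Fin 2)) ∩ T := by
        ext t
        simp only [Finset.mem_filter, Finset.mem_inter, Finset.mem_univ, true_and, he]
        constructor
        · rintro ⟨h1, h2⟩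
          exact ⟨⟨fun h0 => hT0 (h0 ▸ h1), h2⟩, h1⟩
        · rintro ⟨⟨-, h2⟩, h1⟩
          exact ⟨h1, h2⟩
      rw [← e1] at hle
      have h3 := Finset.card_le_card (Finset.inter_subset_right (s₁ :=
        ({a | a ≠ 0} : Finset (Fin (k' + c + 1) → Fin 2))) (s₂ := T))
      have h4 : (2 * ({t ∈ T | (e t).1 = 0}).card : ℝ) ≤ T.card := hle.trans (by exact_mod_cast h3)
      exact_mod_cast h4
    refine Correctable.of_parity_check hed fun u => ?_
    refine ih ({t ∈ T | (e t).1 = 0}.image fun t => (e t).2) ?_ ?_ _ ?_ ?_ ?_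
    · intro h0
      obtain ⟨t, ht, ht0⟩ := Finset.mem_image.mp h0
      have ht' := Finset.mem_filter.mp ht
      have : e t = 0 := Prod.ext ht'.2 ht0
      rw [map_eq_zero_iff e e.injective] at this
      exact hT0 (this ▸ ht'.1)
    · have := Finset.card_image_le (s := {t ∈ T | (e t).1 = 0}) (f := fun t => (e t).2)
      rw [pow_succ] at hT
      omega
    · intro x hx y hy hne
      obtain ⟨x, hx', rfl⟩ := Finset.mem_image.mp hx
      obtain ⟨y, hy', rfl⟩ := Finset.mem_image.mp hy
      obtain ⟨hxE, hxu⟩ := Finset.mem_filter.mp hx'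
      obtain ⟨hyE, hyu⟩ := Finset.mem_filter.mp hy'
      refine Finset.mem_image.mpr ⟨x.1 + y.1, Finset.mem_filter.mpr ⟨hET x hxE y hyE ?_, ?_⟩, ?_⟩
      · intro h0
        exact hne (by rw [h0])
      · rw [map_add, Prod.fst_add, hxu, hyu, bit_add_self]
      · rw [map_add, Prod.snd_add]
    · exact Finset.card_image_le.trans ((Finset.card_filter_le _ _).trans hEM)
    · intro hR x hx y hy
      obtain ⟨x, hx', rfl⟩ := Finset.mem_image.mp hx
      obtain ⟨y, hy', rfl⟩ := Finset.mem_image.mp hy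
      exact congrArg (fun b => (d b).2)
        (hER hR x (Finset.mem_filter.mp hx').1 y (Finset.mem_filter.mp hy').1)

theorem exists_differences {m : ℕ} (A : Finset (Fin m → Fin 2)) :
    ∃ T : Finset (Fin m → Fin 2), 0 ∉ T ∧ T.card ≤ A.card ^ 2 ∧
      ∀ x ∈ A, ∀ y ∈ A, x ≠ y → x + y ∈ T := by
  refine ⟨A.offDiag.image fun p => p.1 + p.2, ?_, ?_, fun x hx y hy hxy => ?_⟩
  · intro h
    obtain ⟨p, hp, h0⟩ := Finset.mem_image.mp h
    exact (Finset.mem_offDiag.mp hp).2.2 (bits_add_eq_zero.mp h0)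
  · refine Finset.card_image_le.trans ?_
    rw [Finset.offDiag_card, sq]
    exact Nat.sub_le _ _
  · exact Finset.mem_image.mpr ⟨(x, y), Finset.mem_offDiag.mpr ⟨hx, hy, hxy⟩, rfl⟩

/-- There are at most `E.card ^ 2` differences of bit errors, so `c'` checks determine the bit
error; after exchanging the roles, `c` checks determine the phase error, and a single error is left
to correct. -/
theorem correctable_of_card_sq_lt {c c' : ℕ}
    (E : Finset ((Fin (k + c + c') → Fin 2) × (Fin (k + c + c') → Fin 2)))
    (hc : E.card ^ 2 < 2 ^ c) (hc' : E.card ^ 2 < 2 ^ c') : Correctable k E := by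
  obtain ⟨T, hT0, hT, hET⟩ := exists_differences (E.image Prod.fst)
  have hle : ∀ {S S' : Type} [DecidableEq S'] (F : Finset S) (f : S → S') {M : ℕ}, F.card ≤ M →
      (F.image f).card ^ 2 ≤ M ^ 2 := @fun _ _ _ F f M h =>
    Nat.pow_le_pow_left (Finset.card_image_le.trans h) 2
  -- The flag `R` records whether the other component of the errors is already determined: `False`
  -- in the first pass, `True` after the swap.
  refine Correctable.of_parity_checks False E.card ?_ c' T hT0
    ((hT.trans (hle E _ le_rfl)).trans_lt hc') E
    (fun x hx y hy => hET _ (Finset.mem_image_of_mem _ hx) _ (Finset.mem_image_of_mem _ hy))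
    le_rfl False.elim
  intro E' hE' hfst _
  refine Correctable.of_swap ?_
  obtain ⟨T, hT0, hT, hET⟩ := exists_differences ((E'.image Prod.swap).image Prod.fst)
  refine Correctable.of_parity_checks True E.card ?_ c T hT0 (lt_of_le_of_lt (hT.trans
    (hle _ _ (Finset.card_image_le.trans hE'))) hc) _
    (fun x hx y hy => hET _ (Finset.mem_image_of_mem _ hx) _ (Finset.mem_image_of_mem _ hy))
    (Finset.card_image_le.trans hE') fun _ x hx y hy => ?_
  · intro F _ h1 h2
    exact correctable_of_subsingleton F fun x hx y hy =>
      Prod.ext (h1 x hx y hy) (h2 trivial x hx y hy)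
  · obtain ⟨x, hx', rfl⟩ := Finset.mem_image.mp hx
    obtain ⟨y, hy', rfl⟩ := Finset.mem_image.mp hy
    exact hfst x hx' y hy'

theorem correctable_of_le {c : ℕ} (h : k + c + c ≤ n)
    (E : Finset ((Fin n → Fin 2) × (Fin n → Fin 2)))
    (hc : E.card ^ 2 < 2 ^ c) : Correctable k E := by
  obtain ⟨j, rfl⟩ := Nat.exists_eq_add_of_le h
  have h' : k + c + c + j = k + c + (c + j) := add_assoc _ _ _
  revert E
  rw [h']
  intro E hc
  exact correctable_of_card_sq_lt E hc
    (hc.trans_le (Nat.pow_le_pow_right two_pos (Nat.le_add_right c j)))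

/-- Discarding singlets does not decrease the overlap. -/
theorem exists_converts_overlap_le {m' m : ℕ} (h : m' ≤ m)
    {ρ : Matrix ((Fin m → Fin 2) × (Fin m → Fin 2)) ((Fin m → Fin 2) × (Fin m → Fin 2)) ℂ}
    (hρ : ρ.PosSemidef) :
    ∃ ω : Matrix ((Fin m' → Fin 2) × (Fin m' → Fin 2)) ((Fin m' → Fin 2) × (Fin m' → Fin 2)) ℂ,
      Converts ρ ω ∧ overlap ρ ≤ overlap ω := by
  obtain ⟨j, rfl⟩ := Nat.exists_eq_add_of_le h
  -- The trivial error alone has no differences, so `T = ∅` and any number `j` of checks can be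
  -- spent to consume the surplus pairs.
  have hg : Correctable m' ({0} : Finset ((Fin (m' + j) → Fin 2) × (Fin (m' + j) → Fin 2))) := by
    refine Correctable.of_parity_checks True 1 (fun E _ h1 h2 => correctable_of_subsingleton E
      fun x hx y hy => Prod.ext (h1 x hx y hy) (h2 trivial x hx y hy)) j ∅ (Finset.notMem_empty _)
      (by simp) _ (by simp) (by simp) (by simp)
  obtain ⟨ω, hω, hle⟩ := hg ρ hρ
  refine ⟨ω, hω, ?_⟩
  simpa [overlap_eq_bellWeight] using hle

end Hashing

/-! ### Distillability under LOCC conversion of several copies -/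

section Monotone

variable {A B A' B' : Type} [Fintype A] [Fintype B] [DecidableEq A] [DecidableEq B]
  [Fintype A'] [Fintype B'] [DecidableEq A'] [DecidableEq B']

/-- A state is distillable if several copies of it can be converted into a distillable state. -/
theorem IsDistillable.of_converts {ρ : Matrix (A × B) (A × B) ℂ} (hρ : IsState ρ) {N : ℕ}
    (hN : 0 < N) {ω : Matrix (A' × B') (A' × B') ℂ} (h : Converts (tensorPow ρ N) ω)
    (hω : IsDistillable ω) : IsDistillable ρ := by
  have hωs : IsState ω := h.isState (isState_tensorPow hρ N)
  obtain ⟨r, hr, hach⟩ := isDistillable_iff.mp hω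
  obtain ⟨Λ, hΛ, hT⟩ := hach.exists_converts hωs
  have hN' : (0 : ℝ≥0) < N := by exact_mod_cast hN
  -- For `n ≥ N` the `k = n / N` complete groups satisfy `n ≤ 2 * N * k`, so the factor `2` absorbs
  -- the rounding. Surplus singlets are discarded.
  refine isDistillable_iff.mpr ⟨r / (2 * N), by positivity, ?_⟩
  refine IsAchievableRate.of_eventually hρ (hT.comp (Nat.tendsto_div_const_atTop hN.ne')) ?_
  filter_upwards [eventually_ge_atTop N] with n hn
  set k := n / N with hk
  have hk1 : 1 ≤ k := (Nat.one_le_div_iff hN).mpr hn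
  have hfl : ⌊(n : ℝ≥0) * (r / (2 * N))⌋₊ ≤ ⌊(k : ℝ≥0) * r⌋₊ := by
    refine Nat.floor_mono ?_
    have h1 : n ≤ 2 * N * k := by
      have h2 := Nat.lt_mul_div_succ n hN
      rw [← hk] at h2
      nlinarith
    have h3 : (n : ℝ≥0) ≤ 2 * N * k := by exact_mod_cast h1
    calc (n : ℝ≥0) * (r / (2 * N)) ≤ 2 * N * k * (r / (2 * N)) := by gcongr
      _ = k * r := by field_simp
  have hst : IsState (Λ k (tensorPow ω k)) :=
    Converts.isState ⟨Λ k, hΛ k, rfl⟩ (isState_tensorPow hωs k)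
  obtain ⟨ω', hω', hle⟩ := exists_converts_overlap_le hfl hst.1
  refine ⟨ω', ?_, hle⟩
  exact (converts_tensorPow_of_le hρ (Nat.div_mul_le_self n N)).trans <|
    (h.tensorPow_mul k).trans <| Converts.trans ⟨Λ k, hΛ k, rfl⟩ hω'

theorem IsDistillable.of_converts_one {ρ : Matrix (A × B) (A × B) ℂ} (hρ : IsState ρ)
    {ω : Matrix (A' × B') (A' × B') ℂ} (h : Converts ρ ω)
    (hω : IsDistillable ω) : IsDistillable ρ :=
  IsDistillable.of_converts hρ one_pos ((converts_tensorPow_one ρ).trans h) hω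

end Monotone

/-! ### Hashing of nearly perfect pairs -/

section HighFidelity

open scoped ComplexOrder Fin.CommRing

theorem sum_sum_prod_eq_prod_sum_sum {R : Type} [CommSemiring R] {n : ℕ}
    (g : Fin n → Fin 2 → Fin 2 → R) :
    ∑ x : Fin n → Fin 2, ∑ y : Fin n → Fin 2, ∏ i, g i (x i) (y i) = ∏ i, ∑ s, ∑ t, g i s t := by
  have h := Finset.prod_univ_sum (fun _ : Fin n => (Finset.univ : Finset (Fin 2)))
    (fun i s => ∑ t, g i s t)
  rw [Fintype.piFinset_univ] at h
  rw [h]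
  refine Finset.sum_congr rfl fun x _ => ?_
  have h := Finset.prod_univ_sum (fun _ : Fin n => (Finset.univ : Finset (Fin 2)))
    (fun i t => g i (x i) t)
  rw [Fintype.piFinset_univ] at h
  exact h.symm

/-- For a distribution of independent errors concentrated on the trivial error, a set of errors of
small exponential growth carries almost all the weight. -/
theorem exists_typical_errors {p : Fin 2 → Fin 2 → ℝ} (hp0 : ∀ s t, 0 ≤ p s t)
    (hp00 : 1 - 1 / 1000000 ≤ p 0 0) (hpsum : ∑ s, ∑ t, p s t = 1) :
    ∃ q : ℝ, 0 ≤ q ∧ q < 1 ∧ ∀ n, 4 ≤ n → ∃ E : Finset ((Fin n → Fin 2) × (Fin n → Fin 2)),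
      E.card ^ 2 < 2 ^ (n / 4) ∧ 1 - q ^ n ≤ ∑ e ∈ E, ∏ i, p (e.1 i) (e.2 i) := by
  set S : ℝ := ∑ s, ∑ t, √(p s t) with hS
  have hS0 : 0 ≤ S := Finset.sum_nonneg fun _ _ => Finset.sum_nonneg fun _ _ => Real.sqrt_nonneg _
  have hS1 : S ≤ 1003 / 1000 := by
    simp only [Fin.sum_univ_two] at hpsum hS
    have hb : ∀ s t, p s t ≤ 1 / 1000000 → √(p s t) ≤ 1 / 1000 := fun s t hst =>
      (Real.sqrt_le_sqrt hst).trans_eq (by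
        rw [show (1 : ℝ) / 1000000 = (1 / 1000) ^ 2 by norm_num, Real.sqrt_sq (by norm_num)])
    have h00 := Real.sqrt_le_one.mpr (show p 0 0 ≤ 1 by
      linarith [hp0 0 1, hp0 1 0, hp0 1 1])
    have h01 := hb 0 1 (by linarith [hp0 1 0, hp0 1 1])
    have h10 := hb 1 0 (by linarith [hp0 0 1, hp0 1 1])
    have h11 := hb 1 1 (by linarith [hp0 0 1, hp0 1 0])
    rw [hS]
    linarith
  -- The threshold `l ^ n` serves two ends: at most `1.05 ^ n` errors have at least this
  -- probability, and the others have total probability at most `(√l * S) ^ n`, where `l * S ^ 2 <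
  -- 1` because `S ≤ 1.003`.
  set l : ℝ := 100 / 105 with hl
  set q : ℝ := √l * S with hq
  have hq0 : 0 ≤ q := by positivity
  have hq1 : q < 1 := by
    have h1 : q ^ 2 < 1 := by
      rw [hq, mul_pow, Real.sq_sqrt (by norm_num [hl]), hl]
      nlinarith
    nlinarith
  refine ⟨q, hq0, hq1, fun n hn => ?_⟩
  set P : (Fin n → Fin 2) × (Fin n → Fin 2) → ℝ := fun e => ∏ i, p (e.1 i) (e.2 i) with hPdef
  have hP0 : ∀ e, 0 ≤ P e := fun e => Finset.prod_nonneg fun _ _ => hp0 _ _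
  have hPsum : ∑ e, P e = 1 := by
    simp only [hPdef, Fintype.sum_prod_type]
    rw [sum_sum_prod_eq_prod_sum_sum fun _ s t => p s t, hpsum, Finset.prod_const_one]
  have hPsqrt : ∑ e, √(P e) = S ^ n := by
    have hr : ∀ a b : Fin n → Fin 2, √(∏ i, p (a i) (b i)) = ∏ i, √(p (a i) (b i)) := fun a b =>
      Real.sqrt_prod _ fun i _ => hp0 _ _
    simp only [hPdef, Fintype.sum_prod_type, hr]
    rw [sum_sum_prod_eq_prod_sum_sum fun _ s t => √(p s t), Finset.prod_const, Finset.card_univ,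
      Fintype.card_fin]
  classical
  set E : Finset ((Fin n → Fin 2) × (Fin n → Fin 2)) := {e | l ^ n ≤ P e} with hE
  have hEcard : (E.card : ℝ) * l ^ n ≤ 1 := by
    rw [← hPsum, ← nsmul_eq_mul, ← Finset.sum_const]
    refine (Finset.sum_le_sum fun e he => (Finset.mem_filter.mp he).2).trans ?_
    exact Finset.sum_le_sum_of_subset_of_nonneg (Finset.subset_univ _) fun _ _ _ => hP0 _
  have hEsum : 1 - q ^ n ≤ ∑ e ∈ E, P e := by
    have h1 := Finset.sum_filter_add_sum_filter_not Finset.univ (fun e => l ^ n ≤ P e) P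
    rw [hPsum] at h1
    have h2 : ∑ e with ¬ l ^ n ≤ P e, P e ≤ q ^ n := by
      calc ∑ e with ¬ l ^ n ≤ P e, P e ≤ ∑ e with ¬ l ^ n ≤ P e, √l ^ n * √(P e) := by
            refine Finset.sum_le_sum fun e he => ?_
            have h3 := (not_le.mp (Finset.mem_filter.mp he).2).le
            have h4 : √(P e) ≤ √l ^ n := by
              refine (Real.sqrt_le_sqrt h3).trans_eq ?_
              rw [Real.sqrt_eq_iff_mul_self_eq (by positivity) (by positivity), ← mul_pow,
                Real.mul_self_sqrt (by norm_num [hl])]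
            calc P e = √(P e) * √(P e) := (Real.mul_self_sqrt (hP0 e)).symm
              _ ≤ √l ^ n * √(P e) := by gcongr
        _ ≤ ∑ e, √l ^ n * √(P e) :=
            Finset.sum_le_sum_of_subset_of_nonneg (Finset.subset_univ _) fun _ _ _ => by positivity
        _ = q ^ n := by rw [← Finset.mul_sum, hPsqrt, hq, mul_pow]
    linarith
  refine ⟨E, ?_, hEsum⟩
  have h1 : (E.card : ℝ) ≤ (105 / 100) ^ n := by
    have h2 : (105 / 100 : ℝ) ^ n * l ^ n = 1 := by
      rw [← mul_pow, hl]
      norm_num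
    have hl0 : 0 < l ^ n := by positivity
    rw [← h2] at hEcard
    exact le_of_mul_le_mul_right hEcard hl0
  -- With `n ≤ 4 * c + 7` the comparison reduces to `1.05 ^ 8 ≤ 2` and `1.05 ^ 14 < 2`.
  obtain ⟨c, hc⟩ : ∃ c, n / 4 = c + 1 := ⟨n / 4 - 1, by omega⟩
  have h3 : n ≤ 4 * c + 7 := by omega
  rw [hc]
  have h4 : (E.card : ℝ) ^ 2 < 2 ^ (c + 1) := by
    calc (E.card : ℝ) ^ 2 ≤ ((105 / 100) ^ n) ^ 2 := by gcongr
      _ ≤ ((105 / 100) ^ (4 * c + 7)) ^ 2 := by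
          gcongr
          norm_num
      _ = ((105 / 100) ^ 8) ^ c * (105 / 100) ^ 14 := by
          rw [← pow_mul, ← pow_mul, ← pow_add]
          congr 1
          ring
      _ < 2 ^ c * 2 := by
          refine mul_lt_mul' (pow_le_pow_left₀ (by norm_num) (by norm_num) c) (by norm_num)
            (by positivity) (by positivity)
      _ = 2 ^ (c + 1) := (pow_succ _ _).symm
  exact_mod_cast h4

variable {τ : Matrix (Fin 2 × Fin 2) (Fin 2 × Fin 2) ℂ}

/-- Signs and matrix entries both factor over the pairs, so the errors on different pairs are
independent. A single pair appears as `tensorPow τ 1` so that its weights have the same form. -/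
theorem bellWeight_tensorPow {n : ℕ} (a b : Fin n → Fin 2) :
    bellWeight (tensorPow τ n) a b =
      ∏ i, bellWeight (tensorPow τ 1) (fun _ => a i) (fun _ => b i) := by
  have h : ∀ {n : ℕ} (a b : Fin n → Fin 2), bellWeight (tensorPow τ n) a b =
      ∏ i, (((2⁻¹ : ℝ) : ℂ) * ∑ s, ∑ t, (bitSign (b i * (s + t)) : ℂ) *
        τ (s, s + a i) (t, t + a i)) := by
    intro n a b
    rw [bellWeight_eq, Finset.prod_mul_distrib, Finset.prod_const, Finset.card_univ,
      Fintype.card_fin, ← sum_sum_prod_eq_prod_sum_sum]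
    congr 1
    · push_cast
      rw [inv_pow]
    · refine Finset.sum_congr rfl fun x _ => Finset.sum_congr rfl fun y _ => ?_
      rw [dotProduct, bitSign_sum, Finset.prod_mul_distrib]
      push_cast
      rfl
  rw [h]
  refine Finset.prod_congr rfl fun i _ => ?_
  rw [h, Fin.prod_univ_one]

/-- A two-qubit state that is close enough to a singlet is distillable. -/
theorem isDistillable_of_overlap_ge (hτ : IsState τ)
    (h : 1 - 1 / 1000000 ≤ overlap (tensorPow τ 1)) : IsDistillable τ := by
  set p : Fin 2 → Fin 2 → ℝ :=
    fun s t => (bellWeight (tensorPow τ 1) (fun _ => s) (fun _ => t)).re with hp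
  have hτ1 := isState_tensorPow hτ 1
  have hp0 : ∀ s t, 0 ≤ p s t := fun s t => bellWeight_nonneg hτ1.1 _ _
  have hp00 : 1 - 1 / 1000000 ≤ p 0 0 := by
    rw [overlap_eq_bellWeight] at h
    exact h
  have hpsum : ∑ s, ∑ t, p s t = 1 := by
    have h1 := congrArg Complex.re (sum_bellWeight (ρ := tensorPow τ 1))
    rw [hτ1.2, Complex.one_re] at h1
    simp only [Complex.re_sum] at h1
    rw [← (Equiv.funUnique (Fin 1) (Fin 2)).symm.sum_comp] at h1
    simp only [← (Equiv.funUnique (Fin 1) (Fin 2)).symm.sum_comp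
      (fun b : Fin 1 → Fin 2 => Complex.re (bellWeight (tensorPow τ 1) _ b))] at h1
    exact h1
  have hP : ∀ {n : ℕ} (a b : Fin n → Fin 2),
      (bellWeight (tensorPow τ n) a b).re = ∏ i, p (a i) (b i) := by
    intro n a b
    have him : ∀ s t, bellWeight (tensorPow τ 1) (fun _ => s) (fun _ => t) = (p s t : ℂ) := by
      intro s t
      refine Complex.ext rfl ?_
      exact (Complex.nonneg_iff.mp (hτ1.1.dotProduct_mulVec_nonneg _)).2.symm
    rw [bellWeight_tensorPow]
    simp only [him]
    rw [← Complex.ofReal_prod, Complex.ofReal_re]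
  -- A quarter of the pairs is kept; about a quarter is allotted to identifying each kind of error,
  -- which is why `exists_typical_errors` has the exponent `n / 4`.
  refine isDistillable_iff.mpr ⟨1 / 4, by norm_num, ?_⟩
  obtain ⟨q, hq0, hq1, hE⟩ := exists_typical_errors hp0 hp00 hpsum
  have hf : Tendsto (fun n : ℕ => 1 - q ^ n) atTop (𝓝 1) := by
    simpa using (tendsto_pow_atTop_nhds_zero_of_lt_one hq0 hq1).const_sub 1
  refine IsAchievableRate.of_eventually hτ hf ?_
  filter_upwards [eventually_ge_atTop 4] with n hn
  obtain ⟨E, hc, hEsum⟩ := hE n hn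
  have hk : 4 * ⌊(n : ℝ≥0) * (1 / 4)⌋₊ ≤ n := by
    have h1 := Nat.floor_le (zero_le (a := (n : ℝ≥0) * (1 / 4)))
    have h2 : (4 * ⌊(n : ℝ≥0) * (1 / 4)⌋₊ : ℝ≥0) ≤ n := by
      calc (4 * ⌊(n : ℝ≥0) * (1 / 4)⌋₊ : ℝ≥0) ≤ 4 * (n * (1 / 4)) := by gcongr
        _ = n := by field_simp
    exact_mod_cast h2
  obtain ⟨ω, hω, hle⟩ := correctable_of_le (k := ⌊(n : ℝ≥0) * (1 / 4)⌋₊) (c := n / 4)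
    (by omega) E hc _ (isState_tensorPow hτ n).1
  refine ⟨ω, hω, hEsum.trans ?_⟩
  simpa only [hP] using hle

end HighFidelity

/-! ### Filtering by postselection, and the overlap bound for nondistillable states -/

section Filtering

open scoped ComplexOrder Fin.CommRing

variable {A B A' B' A'' B'' : Type} [Fintype A] [Fintype B] [DecidableEq A] [DecidableEq B]
  [Fintype A'] [Fintype B'] [DecidableEq A'] [DecidableEq B']
  [Fintype A''] [Fintype B''] [DecidableEq A''] [DecidableEq B'']

/-- `Y` is the unnormalized state that results from `X` if a local filter succeeds; if it fails,
the parties can still use any other system they share. -/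
def FiltersTo (X : Matrix (A × B) (A × B) ℂ) (Y : Matrix (A' × B') (A' × B') ℂ) : Prop :=
  Y.trace.re ≤ X.trace.re ∧
  ∀ {C D : Type} [Fintype C] [Fintype D] [DecidableEq C] [DecidableEq D]
    (W : Matrix (C × D) (C × D) ℂ) (W' : Matrix (A' × B') (A' × B') ℂ), W.trace = 1 →
    Converts W W' → Converts (bitensor X W) (Y + (X.trace - Y.trace) • W')

theorem FiltersTo.refl (X : Matrix (A × B) (A × B) ℂ) : FiltersTo X X := by
  refine ⟨le_rfl, fun W W' hW h => ?_⟩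
  have := (Converts.bitensor_comm X W).trans (Converts.discard_left W X)
  simpa [hW] using this

theorem FiltersTo.of_converts {X : Matrix (A × B) (A × B) ℂ} {X' : Matrix (A'' × B'') (A'' × B'') ℂ}
    {Y : Matrix (A' × B') (A' × B') ℂ} (h : Converts X X') (hY : FiltersTo X' Y) :
    FiltersTo X Y := by
  refine ⟨h.trace_eq ▸ hY.1, fun W W' hW hWW => ?_⟩
  rw [← h.trace_eq]
  exact (h.bitensor_left W).trans (hY.2 W W' hW hWW)

theorem sum_trace_block {S T : Type} [Fintype S] [Fintype T] (e : A ≃ S × A'') (f : B ≃ T × B'')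
    (X : Matrix (A × B) (A × B) ℂ) : ∑ s, ∑ t, (block e f X s t).trace = X.trace := by
  rw [← (Converts.of_block e f X _ fun s t => Converts.refl (block e f X s t)).trace_eq]
  simp only [Matrix.trace_sum]

/-- Every outcome other than `(s₀, t₀)` counts as a failure: that block is discarded and the reserve
system takes over. On `(s₀, t₀)` the given filter continues. -/
theorem FiltersTo.of_block {S T : Type} [Fintype S] [Fintype T]
    (e : A ≃ S × A'') (f : B ≃ T × B'') {X : Matrix (A × B) (A × B) ℂ} (hX : X.PosSemidef)
    (s₀ : S) (t₀ : T) {Y : Matrix (A' × B') (A' × B') ℂ}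
    (h : FiltersTo (block e f X s₀ t₀) Y) : FiltersTo X Y := by
  classical
  have htr := sum_trace_block e f X
  refine ⟨h.1.trans ?_, fun {C D} _ _ _ _ W W' hW hWW => ?_⟩
  · rw [← htr, Complex.re_sum]
    simp only [Complex.re_sum]
    have h0 : ∀ s t, 0 ≤ (block e f X s t).trace.re := fun s t =>
      re_trace_nonneg (block_posSemidef e f hX s t)
    refine le_trans ?_ (Finset.single_le_sum (f := fun s => ∑ t, (block e f X s t).trace.re)
      (fun s _ => Finset.sum_nonneg fun t _ => h0 s t) (Finset.mem_univ s₀))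
    exact Finset.single_le_sum (f := fun t => (block e f X s₀ t).trace.re)
      (fun t _ => h0 s₀ t) (Finset.mem_univ t₀)
  · set e' : A × C ≃ S × (A'' × C) := (e.prodCongr (Equiv.refl C)).trans (Equiv.prodAssoc S A'' C)
    set f' : B × D ≃ T × (B'' × D) := (f.prodCongr (Equiv.refl D)).trans (Equiv.prodAssoc T B'' D)
    have hb : ∀ s t, block e' f' (bitensor X W) s t = bitensor (block e f X s t) W :=
      fun s t => rfl
    have := Converts.of_block e' f' (bitensor X W) (fun s t =>
      (if s = s₀ then if t = t₀ then Y - Y.trace • W' else 0 else 0) +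
        (block e f X s t).trace • W') fun s t => by
        rw [hb]
        by_cases hst : s = s₀ ∧ t = t₀
        · rw [hst.1, hst.2, if_pos rfl, if_pos rfl]
          convert h.2 W W' hW hWW using 1
          rw [sub_smul]
          abel
        · have h0 : (if s = s₀ then if t = t₀ then Y - Y.trace • W' else 0 else 0) = 0 := by
            split_ifs with h1 h2
            · exact absurd ⟨h1, h2⟩ hst
            · rfl
            · rfl
          rw [h0, zero_add]
          exact (Converts.discard_left _ W).trans (hWW.smul _)
    convert this using 1
    have h1 : ∑ s, ∑ t, (if s = s₀ then if t = t₀ then Y - Y.trace • W' else 0 else 0) =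
        Y - Y.trace • W' := by
      rw [Fintype.sum_eq_single s₀ fun s hs => by simp [hs],
        Fintype.sum_eq_single t₀ fun t ht => by simp [ht], if_pos rfl, if_pos rfl]
    simp only [Finset.sum_add_distrib, ← Finset.sum_smul, htr, h1]
    rw [sub_smul]
    abel

/-- Repeating a filter until it succeeds. -/
theorem FiltersTo.exists_converts {k : ℕ} {X : Matrix (A × B) (A × B) ℂ} (hX : IsState X)
    {Y : Matrix ((Fin k → Fin 2) × (Fin k → Fin 2)) ((Fin k → Fin 2) × (Fin k → Fin 2)) ℂ}
    (h : FiltersTo X Y) (hY : Y.PosSemidef) {θ : ℝ} (hθ : 0 ≤ θ)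
    (hlt : θ * Y.trace.re < overlap Y) :
    ∃ N, 0 < N ∧ ∃ ω : Matrix ((Fin k → Fin 2) × (Fin k → Fin 2))
      ((Fin k → Fin 2) × (Fin k → Fin 2)) ℂ, Converts (tensorPow X N) ω ∧ θ ≤ overlap ω := by
  set p := Y.trace.re with hp
  have hYt : Y.trace = (p : ℂ) :=
    Complex.ext rfl (Complex.nonneg_iff.mp hY.trace_nonneg).2.symm
  have hp0 : 0 < p := by
    have h1 := overlap_le_trace hY
    have h2 : 0 ≤ θ * p := mul_nonneg hθ (re_trace_nonneg hY)
    linarith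
  have hp1 : p ≤ 1 := by simpa [hX.2] using h.1
  -- Each new copy succeeds with probability `p` and on failure falls back on the earlier copies, so
  -- the overlap sums a geometric series. With no copies, an arbitrary prepared state gives the
  -- bound `0`.
  have key : ∀ N : ℕ, ∃ ω : Matrix ((Fin k → Fin 2) × (Fin k → Fin 2))
      ((Fin k → Fin 2) × (Fin k → Fin 2)) ℂ, Converts (tensorPow X N) ω ∧
      overlap Y / p * (1 - (1 - p) ^ N) ≤ overlap ω := by
    intro N
    induction N with
    | zero =>
      have h1 := Converts.of_prepare (tensorPow X 0) (0 : Fin k → Fin 2) (0 : Fin k → Fin 2)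
      refine ⟨_, h1, ?_⟩
      rw [pow_zero, sub_self, mul_zero]
      exact overlap_nonneg (h1.posSemidef (isState_tensorPow hX 0).1)
    | succ N ih =>
      obtain ⟨ω, hω, hle⟩ := ih
      have h1 := h.2 _ _ (isState_tensorPow hX N).2 hω
      refine ⟨_, ((converts_tensorPow_add X N 1).trans (Converts.bitensor_comm _ _)).trans
        (((converts_tensorPow_one X).bitensor_left _).trans h1), ?_⟩
      have h2 : X.trace - Y.trace = ((1 - p : ℝ) : ℂ) := by
        rw [hX.2, hYt]
        push_cast
        rfl
      rw [h2, overlap_add, overlap_smul]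
      have h3 : overlap Y / p * (1 - (1 - p) ^ (N + 1)) =
          overlap Y + (1 - p) * (overlap Y / p * (1 - (1 - p) ^ N)) := by
        field_simp
        ring
      rw [h3]
      have := mul_le_mul_of_nonneg_left hle (sub_nonneg.mpr hp1)
      linarith
  have hlim : Tendsto (fun N : ℕ => overlap Y / p * (1 - (1 - p) ^ N)) atTop
      (𝓝 (overlap Y / p)) := by
    have := (tendsto_pow_atTop_nhds_zero_of_lt_one (sub_nonneg.mpr hp1)
      (by linarith : 1 - p < 1)).const_sub 1
    simpa using this.const_mul (overlap Y / p)
  have hθ' : θ < overlap Y / p := (lt_div_iff₀ hp0).mpr hlt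
  obtain ⟨N, hN, hN0⟩ := ((hlim.eventually (lt_mem_nhds hθ')).and (eventually_gt_atTop 0)).exists
  obtain ⟨ω, hω, hle⟩ := key N
  exact ⟨N, hN0, ω, hω, hN.le.trans hle⟩

variable {n : ℕ}

/-- A weighted sum of the Bell weights. -/
noncomputable def errorWeight (G : (Fin n → Fin 2) → (Fin n → Fin 2) → ℝ)
    (ρ : Matrix ((Fin n → Fin 2) × (Fin n → Fin 2)) ((Fin n → Fin 2) × (Fin n → Fin 2)) ℂ) : ℝ :=
  ∑ a, ∑ b, G a b * (bellWeight ρ a b).re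

/-- The weight of the nontrivial bit errors. -/
noncomputable def bitErrorWeight
    (ρ : Matrix ((Fin n → Fin 2) × (Fin n → Fin 2)) ((Fin n → Fin 2) × (Fin n → Fin 2)) ℂ) : ℝ :=
  errorWeight (fun a _ => if a = 0 then 0 else 1) ρ

/-- The weight of the nontrivial phase errors. -/
noncomputable def phaseErrorWeight
    (ρ : Matrix ((Fin n → Fin 2) × (Fin n → Fin 2)) ((Fin n → Fin 2) × (Fin n → Fin 2)) ℂ) : ℝ :=
  errorWeight (fun _ b => if b = 0 then 0 else 1) ρ

theorem errorWeight_mono {G G' : (Fin n → Fin 2) → (Fin n → Fin 2) → ℝ}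
    (h : ∀ a b, G a b ≤ G' a b)
    {ρ : Matrix ((Fin n → Fin 2) × (Fin n → Fin 2)) ((Fin n → Fin 2) × (Fin n → Fin 2)) ℂ}
    (hρ : ρ.PosSemidef) : errorWeight G ρ ≤ errorWeight G' ρ :=
  Finset.sum_le_sum fun a _ => Finset.sum_le_sum fun b _ =>
    mul_le_mul_of_nonneg_right (h a b) (bellWeight_nonneg hρ a b)

theorem errorWeight_one
    (ρ : Matrix ((Fin n → Fin 2) × (Fin n → Fin 2)) ((Fin n → Fin 2) × (Fin n → Fin 2)) ℂ) :
    errorWeight (fun _ _ => 1) ρ = ρ.trace.re := by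
  rw [← sum_bellWeight]
  simp [errorWeight, Complex.re_sum]

theorem errorWeight_single
    (ρ : Matrix ((Fin n → Fin 2) × (Fin n → Fin 2)) ((Fin n → Fin 2) × (Fin n → Fin 2)) ℂ) :
    errorWeight (fun a b => if a = 0 then if b = 0 then 1 else 0 else 0) ρ = overlap ρ := by
  simp only [errorWeight, ite_mul, one_mul, zero_mul, overlap_eq_bellWeight]
  rw [Finset.sum_eq_single 0]
  · simp
  · intro a _ ha
    simp [ha]
  · simp

/-- Equal outcomes mean syndrome `0`, so only errors with `(e a).1 = 0` survive, and their conjugate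
phase bit is forgotten. -/
theorem sum_errorWeight_block
    (ρ : Matrix ((Fin (n + 1) → Fin 2) × (Fin (n + 1) → Fin 2))
      ((Fin (n + 1) → Fin 2) × (Fin (n + 1) → Fin 2)) ℂ)
    {e d : (Fin (n + 1) → Fin 2) ≃+ Fin 2 × (Fin n → Fin 2)}
    (hed : ∀ b x, b ⬝ᵥ x = (d b).1 * (e x).1 + (d b).2 ⬝ᵥ (e x).2)
    (G : (Fin n → Fin 2) → (Fin n → Fin 2) → ℝ) :
    ∑ s, errorWeight G (block e.toEquiv e.toEquiv ρ s s) =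
      errorWeight (fun a b => if (e a).1 = 0 then G (e a).2 (d b).2 else 0) ρ := by
  have h : ∀ a b, ∑ s, (bellWeight (block e.toEquiv e.toEquiv ρ s s) a b).re =
      ∑ β, (bellWeight ρ (e.symm (0, a)) (d.symm (β, b))).re := by
    intro a b
    have := sum_bellWeight_block (ρ := ρ) hed 0 a b
    simp only [add_zero] at this
    rw [← Complex.re_sum, this, Complex.re_sum]
  have hL : ∑ s, errorWeight G (block e.toEquiv e.toEquiv ρ s s) =
      ∑ a, ∑ b, G a b * ∑ β, (bellWeight ρ (e.symm (0, a)) (d.symm (β, b))).re := by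
    simp only [errorWeight, ← h, Finset.mul_sum]
    rw [Finset.sum_comm]
    exact Finset.sum_congr rfl fun a _ => Finset.sum_comm
  rw [hL, errorWeight, ← e.symm.toEquiv.sum_comp, Fintype.sum_prod_type, Fin.sum_univ_two]
  have h1 : ∀ a, (e (e.symm.toEquiv (1, a))).1 = 1 := fun a =>
    congrArg Prod.fst (e.apply_symm_apply (1, a))
  have h0 : ∀ a, e (e.symm.toEquiv (0, a)) = (0, a) := fun a => e.apply_symm_apply (0, a)
  simp only [h1, h0, one_ne_zero, if_false, if_true, zero_mul, Finset.sum_const_zero, add_zero]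
  refine Finset.sum_congr rfl fun a _ => ?_
  rw [← d.symm.toEquiv.sum_comp, Fintype.sum_prod_type, Finset.sum_comm]
  refine Finset.sum_congr rfl fun b _ => ?_
  rw [Finset.mul_sum]
  refine Finset.sum_congr rfl fun β _ => ?_
  have h2 : d (d.symm.toEquiv (β, b)) = (β, b) := d.apply_symm_apply (β, b)
  rw [h2]
  rfl

/-- Postselecting on a good parity check halves the weight of the bit errors. -/
theorem exists_filter_step
    {ρ : Matrix ((Fin (n + 1) → Fin 2) × (Fin (n + 1) → Fin 2))
      ((Fin (n + 1) → Fin 2) × (Fin (n + 1) → Fin 2)) ℂ} (hρ : ρ.PosSemidef)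
    {x y z : ℝ} (hx : 0 ≤ x) (hy : 0 ≤ y) (hz : 0 ≤ z)
    (h : y / 2 * bitErrorWeight ρ + z * phaseErrorWeight ρ < x * overlap ρ) :
    ∃ ρ' : Matrix ((Fin n → Fin 2) × (Fin n → Fin 2)) ((Fin n → Fin 2) × (Fin n → Fin 2)) ℂ,
      ρ'.PosSemidef ∧ y * bitErrorWeight ρ' + z * phaseErrorWeight ρ' < x * overlap ρ' ∧
      ∀ {A B : Type} [Fintype A] [Fintype B] [DecidableEq A] [DecidableEq B]
        (Y : Matrix (A × B) (A × B) ℂ), FiltersTo ρ' Y → FiltersTo ρ Y := by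
  obtain ⟨c, hc, hle⟩ := exists_parity_check (fun a => ∑ b, (bellWeight ρ a b).re)
    fun a => Finset.sum_nonneg fun b _ => bellWeight_nonneg hρ a b
  obtain ⟨e, d, he, hed⟩ := exists_parity_equiv hc
  -- Only an inequality: a phase error confined to the forgotten bit becomes trivial, which can add
  -- to the overlap. For the same reason the phase error weight can only drop.
  have h1 : overlap ρ ≤ ∑ s, overlap (block e.toEquiv e.toEquiv ρ s s) := by
    simp only [← errorWeight_single]
    rw [sum_errorWeight_block ρ hed]
    refine errorWeight_mono (fun a b => ?_) hρ
    by_cases ha : a = 0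
    · by_cases hb : b = 0
      · simp [ha, hb]
      · simp only [ha, hb, if_true, if_false]
        positivity
    · simp only [ha, if_false]
      positivity
  have h2 : 2 * ∑ s, bitErrorWeight (block e.toEquiv e.toEquiv ρ s s) ≤ bitErrorWeight ρ := by
    simp only [bitErrorWeight]
    rw [sum_errorWeight_block ρ hed]
    simp only [errorWeight, ← Finset.mul_sum]
    rw [Finset.sum_filter, Finset.sum_filter] at hle
    refine le_trans (le_of_eq ?_) (hle.trans (le_of_eq ?_))
    · congr 1
      refine Finset.sum_congr rfl fun a _ => ?_
      have h0 : a = 0 ↔ (e a).1 = 0 ∧ (e a).2 = 0 := by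
        rw [← map_eq_zero_iff e e.injective, Prod.ext_iff]
        rfl
      rw [← he, ite_mul, ite_mul]
      by_cases h3 : (e a).1 = 0 <;> by_cases h4 : (e a).2 = 0 <;> simp [h0, h3, h4]
    · refine Finset.sum_congr rfl fun a _ => ?_
      by_cases ha : a = 0 <;> simp [ha]
  have h3 : ∑ s, phaseErrorWeight (block e.toEquiv e.toEquiv ρ s s) ≤ phaseErrorWeight ρ := by
    simp only [phaseErrorWeight]
    rw [sum_errorWeight_block ρ hed]
    refine errorWeight_mono (fun a b => ?_) hρ
    by_cases hb : b = 0
    · simp [hb]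
    · simp only [hb, if_false]
      split_ifs <;> norm_num
  -- The desired inequality holds for the sum over both common outcomes, hence for one of them.
  obtain ⟨s, hs⟩ : ∃ s, y * bitErrorWeight (block e.toEquiv e.toEquiv ρ s s) +
      z * phaseErrorWeight (block e.toEquiv e.toEquiv ρ s s) <
      x * overlap (block e.toEquiv e.toEquiv ρ s s) := by
    by_contra! hcon
    have h4 := Finset.sum_le_sum fun s (_ : s ∈ (Finset.univ : Finset (Fin 2))) => hcon s
    rw [Finset.sum_add_distrib, ← Finset.mul_sum, ← Finset.mul_sum, ← Finset.mul_sum] at h4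
    have h5 := mul_le_mul_of_nonneg_left h1 hx
    have h6 := mul_le_mul_of_nonneg_left h2 hy
    have h7 := mul_le_mul_of_nonneg_left h3 hz
    linarith
  exact ⟨_, block_posSemidef _ _ hρ s s, hs, fun Y hY => FiltersTo.of_block _ _ hρ s s hY⟩

/-- Each check is chosen for the state left by the previous one and gains a factor `2` on the bit
errors, at no cost in the phase errors. -/
theorem exists_filter_steps {k : ℕ} {x y z : ℝ} (hx : 0 ≤ x) (hy : 0 ≤ y) (hz : 0 ≤ z) (c : ℕ)
    {ρ : Matrix ((Fin (k + c) → Fin 2) × (Fin (k + c) → Fin 2))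
      ((Fin (k + c) → Fin 2) × (Fin (k + c) → Fin 2)) ℂ} (hρ : ρ.PosSemidef)
    (h : y / 2 ^ c * bitErrorWeight ρ + z * phaseErrorWeight ρ < x * overlap ρ) :
    ∃ ρ' : Matrix ((Fin k → Fin 2) × (Fin k → Fin 2)) ((Fin k → Fin 2) × (Fin k → Fin 2)) ℂ,
      ρ'.PosSemidef ∧ y * bitErrorWeight ρ' + z * phaseErrorWeight ρ' < x * overlap ρ' ∧
      ∀ {A B : Type} [Fintype A] [Fintype B] [DecidableEq A] [DecidableEq B]
        (Y : Matrix (A × B) (A × B) ℂ), FiltersTo ρ' Y → FiltersTo ρ Y := by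
  induction c with
  | zero => exact ⟨ρ, hρ, by simpa using h, fun Y hY => hY⟩
  | succ c ih =>
    obtain ⟨ρ₁, hρ₁, h₁, hf₁⟩ := exists_filter_step (y := y / 2 ^ c) hρ hx (by positivity) hz
      (by rwa [div_div, ← pow_succ])
    obtain ⟨ρ₂, hρ₂, h₂, hf₂⟩ := ih hρ₁ h₁
    exact ⟨ρ₂, hρ₂, h₂, fun Y hY => hf₁ Y (hf₂ Y hY)⟩

theorem exists_swap_errors
    {ρ : Matrix ((Fin n → Fin 2) × (Fin n → Fin 2)) ((Fin n → Fin 2) × (Fin n → Fin 2)) ℂ}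
    (hρ : ρ.PosSemidef) :
    ∃ ρ' : Matrix ((Fin n → Fin 2) × (Fin n → Fin 2)) ((Fin n → Fin 2) × (Fin n → Fin 2)) ℂ,
      ρ'.PosSemidef ∧ Converts ρ ρ' ∧ overlap ρ' = overlap ρ ∧
      bitErrorWeight ρ' = phaseErrorWeight ρ ∧ phaseErrorWeight ρ' = bitErrorWeight ρ := by
  have hH : (hadamard n)ᴴ * hadamard n = 1 := by rw [hadamard_conjTranspose, hadamard_mul_self]
  refine ⟨_, hρ.mul_mul_conjTranspose_same (hadamard n ⊗ₖ hadamard n),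
    Converts.of_isometry ρ _ hH _ hH, ?_, ?_, ?_⟩
  · rw [overlap_eq_bellWeight, overlap_eq_bellWeight, bellWeight_hadamard]
  · simp only [bitErrorWeight, phaseErrorWeight, errorWeight, bellWeight_hadamard]
    exact Finset.sum_comm
  · simp only [bitErrorWeight, phaseErrorWeight, errorWeight, bellWeight_hadamard]
    exact Finset.sum_comm

/-- Filtering by parity checks a state whose overlap is not too small. -/
theorem exists_filtersTo {k c c' : ℕ} {δ : ℝ} (hδ : 0 ≤ δ) (hδ1 : δ ≤ 1) (hc : c ≤ c')
    {ρ : Matrix ((Fin (k + c + c') → Fin 2) × (Fin (k + c + c') → Fin 2))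
      ((Fin (k + c + c') → Fin 2) × (Fin (k + c + c') → Fin 2)) ℂ} (hρ : IsState ρ)
    (h : 2 / 2 ^ c < δ * overlap ρ) :
    ∃ Y : Matrix ((Fin k → Fin 2) × (Fin k → Fin 2)) ((Fin k → Fin 2) × (Fin k → Fin 2)) ℂ,
      Y.PosSemidef ∧ FiltersTo ρ Y ∧ (1 - δ) * Y.trace.re < overlap Y := by
  have hb : bitErrorWeight ρ ≤ 1 := by
    rw [← Complex.one_re, ← hρ.2, ← errorWeight_one]
    exact errorWeight_mono (fun a b => by split_ifs <;> norm_num) hρ.1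
  have hp : phaseErrorWeight ρ ≤ 1 := by
    rw [← Complex.one_re, ← hρ.2, ← errorWeight_one]
    exact errorWeight_mono (fun a b => by split_ifs <;> norm_num) hρ.1
  have hpow : (1 : ℝ) / 2 ^ c' ≤ 1 / 2 ^ c := by
    gcongr
    norm_num
  -- The coefficients anticipate the two passes: `c'` checks lift the first to `1 - δ`, and after
  -- the swap `c` checks lift the second.
  have h0 : (1 - δ) / 2 ^ c' * bitErrorWeight ρ + (1 - δ) / 2 ^ c * phaseErrorWeight ρ <
      δ * overlap ρ := by
    refine lt_of_le_of_lt ?_ h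
    have hpos : (0 : ℝ) ≤ 1 / 2 ^ c := by positivity
    have hpos' : (0 : ℝ) ≤ 1 / 2 ^ c' := by positivity
    have h1 : (1 - δ) / 2 ^ c' * bitErrorWeight ρ ≤ 1 / 2 ^ c := by
      calc (1 - δ) / 2 ^ c' * bitErrorWeight ρ ≤ (1 - δ) / 2 ^ c' * 1 := by
            exact mul_le_mul_of_nonneg_left (by assumption)
              (div_nonneg (by linarith) (by positivity))
        _ ≤ 1 / 2 ^ c' := by rw [mul_one]; gcongr; linarith
        _ ≤ _ := hpow
    have h2 : (1 - δ) / 2 ^ c * phaseErrorWeight ρ ≤ 1 / 2 ^ c := by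
      calc (1 - δ) / 2 ^ c * phaseErrorWeight ρ ≤ (1 - δ) / 2 ^ c * 1 := by
            exact mul_le_mul_of_nonneg_left (by assumption)
              (div_nonneg (by linarith) (by positivity))
        _ ≤ 1 / 2 ^ c := by rw [mul_one]; gcongr; linarith
    calc _ ≤ (1 : ℝ) / 2 ^ c + 1 / 2 ^ c := add_le_add h1 h2
      _ = 2 / 2 ^ c := by ring
  obtain ⟨ρ₁, hρ₁, h₁, hf₁⟩ := exists_filter_steps hδ (by linarith : 0 ≤ 1 - δ)
    (div_nonneg (by linarith) (by positivity)) c' hρ.1 h0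
  obtain ⟨ρ₂, hρ₂, hf₂, ho₂, hb₂, hp₂⟩ := exists_swap_errors hρ₁
  obtain ⟨ρ₃, hρ₃, h₃, hf₃⟩ := exists_filter_steps (y := 1 - δ) (z := 1 - δ) hδ (by linarith)
    (by linarith) c hρ₂ (by rw [ho₂, hb₂, hp₂]; linarith)
  refine ⟨ρ₃, hρ₃, hf₁ _ (FiltersTo.of_converts hf₂ (hf₃ _ (FiltersTo.refl ρ₃))), ?_⟩
  -- Union bound: an error is trivial, or its bit part is not, or its phase part is not.
  have htr : ρ₃.trace.re ≤ overlap ρ₃ + (bitErrorWeight ρ₃ + phaseErrorWeight ρ₃) := by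
    rw [← errorWeight_one, ← errorWeight_single, bitErrorWeight, phaseErrorWeight]
    simp only [errorWeight, ← Finset.sum_add_distrib, ← add_mul]
    refine errorWeight_mono (fun a b => ?_) hρ₃
    split_ifs <;> norm_num
  nlinarith

/-- Nondistillable states have small overlap with many singlets. -/
theorem overlap_le_of_not_isDistillable {m : ℕ}
    {σ : Matrix ((Fin m → Fin 2) × (Fin m → Fin 2)) ((Fin m → Fin 2) × (Fin m → Fin 2)) ℂ}
    (hσ : IsState σ) (hd : ¬ IsDistillable σ) :
    overlap σ ≤ 2000000 / 2 ^ ((m - 1) / 2) := by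
  by_contra! hlt
  refine hd ?_
  have hm : 1 ≤ m := by
    by_contra! hm
    have h1 := overlap_le_trace hσ.1
    rw [hσ.2, Complex.one_re] at h1
    have : (m - 1) / 2 = 0 := by omega
    rw [this] at hlt
    norm_num at hlt
    linarith
  -- One pair is kept and the other `m - 1` are shared between the two passes; `m = 0` was excluded
  -- above, where the bound exceeds `1`.
  obtain ⟨c, c', hcc, hmc, hceq⟩ : ∃ c c', c ≤ c' ∧ m = 1 + c + c' ∧ (m - 1) / 2 = c :=
    ⟨(m - 1) / 2, (m - 1) - (m - 1) / 2, by omega, by omega, rfl⟩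
  rw [hceq] at hlt
  clear hceq hm
  subst hmc
  -- `δ` is the infidelity tolerated by `isDistillable_of_overlap_ge`; the constant in the bound is
  -- `2 / δ`.
  obtain ⟨Y, hY, hf, hYlt⟩ := exists_filtersTo (k := 1) (δ := 1 / 1000000) (by norm_num)
    (by norm_num) hcc hσ (by
      have : (2 : ℝ) / 2 ^ c = 1 / 1000000 * (2000000 / 2 ^ c) := by ring
      rw [this]
      exact mul_lt_mul_of_pos_left hlt (by norm_num))
  obtain ⟨N, hN, ω, hω, hle⟩ := hf.exists_converts hσ hY (by norm_num) hYlt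
  set τ : Matrix (Fin 2 × Fin 2) (Fin 2 × Fin 2) ℂ := ω.submatrix
    ((Equiv.funUnique (Fin 1) (Fin 2)).prodCongr (Equiv.funUnique (Fin 1) (Fin 2))).symm
    ((Equiv.funUnique (Fin 1) (Fin 2)).prodCongr (Equiv.funUnique (Fin 1) (Fin 2))).symm with hτ
  have hτω : tensorPow τ 1 = ω := by
    rw [tensorPow_one_submatrix, hτ, Matrix.submatrix_submatrix, Equiv.symm_comp_self,
      Matrix.submatrix_id_id]
  have hconv : Converts (tensorPow σ N) τ :=
    hω.trans (Converts.reindex (Equiv.funUnique (Fin 1) (Fin 2))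
      (Equiv.funUnique (Fin 1) (Fin 2)) ω)
  refine IsDistillable.of_converts hσ hN hconv ?_
  exact isDistillable_of_overlap_ge (hconv.isState (isState_tensorPow hσ N)) (by rwa [hτω])

end Filtering

/-! ### Bounds on the two distillability measures -/

section Main

open scoped ComplexOrder

/-- The triangle inequality for the trace norm, through the contraction that attains it. -/
theorem traceDist_le_one {S : Type} [Fintype S] [DecidableEq S] {ρ σ : Matrix S S ℂ}
    (hρ : IsState ρ) (hσ : IsState σ) : traceDist ρ σ ≤ 1 := by
  obtain ⟨R, hR, hRR, -⟩ := hρ.1.exists_hermitian_sq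
  obtain ⟨Q, hQ, hQQ, -⟩ := hσ.1.exists_hermitian_sq
  obtain ⟨U, hU, hUX⟩ := exists_contraction_trace_sqrt (ρ - σ)
  have b1 := re_trace_contraction_mul_le hU R R
  have b2 := re_trace_contraction_mul_le hU (-Q) Q
  rw [hR, hRR, hρ.2, Complex.one_re, Real.sqrt_one, mul_one] at b1
  rw [Matrix.conjTranspose_neg, hQ, neg_mul_neg, neg_mul, hQQ, hσ.2, Complex.one_re,
    Real.sqrt_one, mul_one] at b2
  have e : ρ - σ = ρ + -σ := sub_eq_add_neg _ _
  have hT : traceNorm (ρ - σ) = (U * ρ).trace.re + (U * -σ).trace.re := by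
    rw [traceNorm, hUX, ← Complex.add_re, ← Matrix.trace_add, ← Matrix.mul_add, ← e]
  rw [traceDist, hT]
  linarith

variable {A B : Type} [Fintype A] [Fintype B] [DecidableEq A] [DecidableEq B]
  {ρ : Matrix (A × B) (A × B) ℂ}

theorem IsState.nonempty (hρ : IsState ρ) : Nonempty A ∧ Nonempty B := by
  have h : Nonempty (A × B) := by
    by_contra h
    rw [not_nonempty_iff] at h
    have := hρ.2
    rw [Matrix.trace_eq_zero_of_isEmpty] at this
    exact zero_ne_one this
  exact ⟨h.map Prod.fst, h.map Prod.snd⟩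

/-- The overlap with singlets after an LOCC protocol is the probability of a measurement outcome
on the initial state. -/
theorem IsLOCC.exists_effect {m : ℕ} {Λ : Matrix (A × B) (A × B) ℂ →
      Matrix ((Fin m → Fin 2) × (Fin m → Fin 2)) ((Fin m → Fin 2) × (Fin m → Fin 2)) ℂ}
    (h : IsLOCC (Fin m → Fin 2) (Fin m → Fin 2) A B Λ) :
    ∃ M : Matrix (A × B) (A × B) ℂ, M.PosSemidef ∧ (1 - M).PosSemidef ∧
      ∀ X, (M * X).trace.re = overlap (Λ X) := by
  obtain ⟨Φ, h1, hs, hp, ht⟩ := h.exists_dual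
  refine ⟨Φ (tensorPow phiPlus m), hp _ (posSemidef_tensorPow_phiPlus m), ?_, fun X => ?_⟩
  · rw [← h1, ← hs]
    exact hp _ (posSemidef_one_sub_tensorPow_phiPlus m)
  · rw [ht, overlap]

/-- A distillable output would make the input distillable, so the singlet bound applies to the
output, uniformly in `σ`. -/
theorem IsLOCC.overlap_le {m : ℕ} {Λ : Matrix (A × B) (A × B) ℂ →
      Matrix ((Fin m → Fin 2) × (Fin m → Fin 2)) ((Fin m → Fin 2) × (Fin m → Fin 2)) ℂ}
    (h : IsLOCC (Fin m → Fin 2) (Fin m → Fin 2) A B Λ) {σ : Matrix (A × B) (A × B) ℂ}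
    (hσ : σ ∈ nondistillableStates A B) : overlap (Λ σ) ≤ 2000000 / 2 ^ ((m - 1) / 2) :=
  overlap_le_of_not_isDistillable (Converts.isState ⟨Λ, h, rfl⟩ hσ.1)
    fun hd => hσ.2 (IsDistillable.of_converts_one hσ.1 ⟨Λ, h, rfl⟩ hd)

theorem IsLOCC.le_traceDistillability {m : ℕ} {Λ : Matrix (A × B) (A × B) ℂ →
      Matrix ((Fin m → Fin 2) × (Fin m → Fin 2)) ((Fin m → Fin 2) × (Fin m → Fin 2)) ℂ}
    (h : IsLOCC (Fin m → Fin 2) (Fin m → Fin 2) A B Λ) (hρ : IsState ρ) :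
    overlap (Λ ρ) - 2000000 / 2 ^ ((m - 1) / 2) ≤ traceDistillability ρ := by
  obtain ⟨hA, hB⟩ := hρ.nonempty
  refine le_csInf (exists_nondistillable.image _) ?_
  rintro _ ⟨σ, hσ, rfl⟩
  obtain ⟨M, hM, hM1, hMX⟩ := h.exists_effect
  have h1 := re_trace_mul_sub_le_traceDist hρ hσ.1 hM hM1
  rw [hMX, hMX] at h1
  have h2 := h.overlap_le hσ
  linarith

/-- In the two-outcome fidelity bound, the success term is small because of `σ` and the failure term
because of `ρ`. -/
theorem IsLOCC.one_sub_le_geomDistillability {m : ℕ} {Λ : Matrix (A × B) (A × B) ℂ →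
      Matrix ((Fin m → Fin 2) × (Fin m → Fin 2)) ((Fin m → Fin 2) × (Fin m → Fin 2)) ℂ}
    (h : IsLOCC (Fin m → Fin 2) (Fin m → Fin 2) A B Λ) (hρ : IsState ρ) :
    1 - (√(2000000 / 2 ^ ((m - 1) / 2)) + √(1 - overlap (Λ ρ))) ≤ geomDistillability ρ := by
  obtain ⟨hA, hB⟩ := hρ.nonempty
  refine sub_le_sub_left (csSup_le (exists_nondistillable.image _) ?_) 1
  rintro _ ⟨σ, hσ, rfl⟩
  obtain ⟨M, hM, hM1, hMX⟩ := h.exists_effect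
  have hc : ∀ {τ : Matrix (A × B) (A × B) ℂ}, IsState τ →
      ((1 - M) * τ).trace.re = 1 - overlap (Λ τ) := by
    intro τ hτ
    rw [Matrix.sub_mul, Matrix.one_mul, Matrix.trace_sub, Complex.sub_re, hMX, hτ.2, Complex.one_re]
  have h01 : ∀ {τ : Matrix (A × B) (A × B) ℂ}, IsState τ →
      0 ≤ overlap (Λ τ) ∧ overlap (Λ τ) ≤ 1 := by
    intro τ hτ
    have hs := Converts.isState (Y := Λ τ) ⟨Λ, h, rfl⟩ hτ
    have := overlap_le_trace hs.1
    rw [hs.2, Complex.one_re] at this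
    exact ⟨overlap_nonneg hs.1, this⟩
  refine (fidelity_le hρ.1 hσ.1.1 hM hM1).trans ?_
  rw [hMX, hMX, hc hσ.1, hc hρ]
  refine add_le_add ?_ ?_
  · refine (mul_le_of_le_one_right (Real.sqrt_nonneg _) (Real.sqrt_le_one.mpr (h01 hρ).2)).trans ?_
    exact Real.sqrt_le_sqrt (h.overlap_le hσ)
  · exact mul_le_of_le_one_left (Real.sqrt_nonneg _)
      (Real.sqrt_le_one.mpr (by linarith [(h01 hσ.1).1]))

theorem traceDistillability_le_one (hρ : IsState ρ) : traceDistillability ρ ≤ 1 := by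
  obtain ⟨hA, hB⟩ := hρ.nonempty
  obtain ⟨σ, hσ⟩ := exists_nondistillable (A := A) (B := B)
  have hb : BddBelow (traceDist ρ '' nondistillableStates A B) :=
    ⟨0, by rintro _ ⟨τ, -, rfl⟩; exact traceDist_nonneg _ _⟩
  exact (csInf_le hb ⟨σ, hσ, rfl⟩).trans (traceDist_le_one hρ hσ.1)

theorem geomDistillability_le_one : geomDistillability ρ ≤ 1 :=
  sub_le_self _ (Real.sSup_nonneg (by rintro _ ⟨σ, -, rfl⟩; exact fidelity_nonneg _ _))

theorem traceDistillability_eq_zero (hρ : ρ ∈ nondistillableStates A B) :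
    traceDistillability ρ = 0 := by
  refine IsLeast.csInf_eq ⟨⟨ρ, hρ, traceDist_self ρ⟩, ?_⟩
  rintro _ ⟨σ, -, rfl⟩
  exact traceDist_nonneg _ _

theorem geomDistillability_eq_zero (hρ : ρ ∈ nondistillableStates A B) :
    geomDistillability ρ = 0 := by
  have h : IsGreatest (fidelity ρ '' nondistillableStates A B) 1 := by
    refine ⟨⟨ρ, hρ, fidelity_self hρ.1⟩, ?_⟩
    rintro _ ⟨σ, hσ, rfl⟩
    exact fidelity_le_one hρ.1 hσ.1
  rw [geomDistillability, h.csSup_eq, sub_self]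

/-- Distilling from copies of a power is distilling from copies of `ρ`, at a reduced but positive
rate. -/
theorem tensorPow_mem_nondistillableStates (hρ : ρ ∈ nondistillableStates A B) {n : ℕ}
    (hn : 0 < n) : tensorPow ρ n ∈ nondistillableStates (Fin n → A) (Fin n → B) :=
  ⟨isState_tensorPow hρ.1 n, fun h => hρ.2 (IsDistillable.of_converts hρ.1 hn (.refl _) h)⟩

theorem tendsto_overlap_bound {r : ℝ≥0} (hr : 0 < r) :
    Tendsto (fun n : ℕ => (2000000 : ℝ) / 2 ^ ((⌊(n : ℝ≥0) * r⌋₊ - 1) / 2)) atTop (𝓝 0) := by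
  have h1 : Tendsto (fun n : ℕ => ⌊(n : ℝ≥0) * r⌋₊) atTop atTop :=
    tendsto_nat_floor_atTop.comp (tendsto_natCast_atTop_atTop.atTop_mul_const hr)
  have h2 : Tendsto (fun m : ℕ => (m - 1) / 2) atTop atTop :=
    (Nat.tendsto_div_const_atTop two_ne_zero).comp (tendsto_sub_atTop_nat 1)
  exact tendsto_const_nhds.div_atTop
    ((tendsto_pow_atTop_atTop_of_one_lt one_lt_two).comp (h2.comp h1))

end Main
end GeometricDistillability

theorem mainTheorem4 {A B : Type} [Fintype A] [Fintype B] [DecidableEq A] [DecidableEq B]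
    (ρ : Matrix (A × B) (A × B) ℂ) (hρ : GeometricDistillability.IsState ρ) :
    (GeometricDistillability.IsDistillable ρ →
      Tendsto (fun n : ℕ => GeometricDistillability.geomDistillability
        (GeometricDistillability.tensorPow ρ n)) atTop (𝓝 1) ∧
      Tendsto (fun n : ℕ => GeometricDistillability.traceDistillability
        (GeometricDistillability.tensorPow ρ n)) atTop (𝓝 1)) ∧
    (¬ GeometricDistillability.IsDistillable ρ →
      GeometricDistillability.geomDistillability ρ = 0 ∧
      GeometricDistillability.traceDistillability ρ = 0 ∧
      Tendsto (fun n : ℕ => GeometricDistillability.geomDistillability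
        (GeometricDistillability.tensorPow ρ n)) atTop (𝓝 0) ∧
      Tendsto (fun n : ℕ => GeometricDistillability.traceDistillability
        (GeometricDistillability.tensorPow ρ n)) atTop (𝓝 0)) := by
  open GeometricDistillability in
  refine ⟨fun hd => ?_, fun hd => ?_⟩
  · obtain ⟨r, hr, h⟩ := isDistillable_iff.mp hd
    obtain ⟨Λ, hΛ, hT⟩ := h.exists_converts hρ
    have hκ := tendsto_overlap_bound hr
    have hs := isState_tensorPow hρ
    constructor
    -- Both measures are squeezed between `1` and a bound governed by the overlap tending to `1` and
    -- the singlet bound tending to `0` as `⌊n r⌋` grows.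
    · refine tendsto_of_tendsto_of_tendsto_of_le_of_le ?_ tendsto_const_nhds
        (fun n => (hΛ n).one_sub_le_geomDistillability (hs n)) fun n => geomDistillability_le_one
      have h1 : Tendsto (fun n : ℕ => 1 - overlap (Λ n (tensorPow ρ n))) atTop (𝓝 0) := by
        simpa using hT.const_sub 1
      simpa using (hκ.sqrt.add h1.sqrt).const_sub 1
    · refine tendsto_of_tendsto_of_tendsto_of_le_of_le ?_ tendsto_const_nhds
        (fun n => (hΛ n).le_traceDistillability (hs n)) fun n => traceDistillability_le_one (hs n)
      simpa using hT.sub hκ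
  · have hρn : ρ ∈ nondistillableStates A B := ⟨hρ, hd⟩
    refine ⟨geomDistillability_eq_zero hρn, traceDistillability_eq_zero hρn, ?_, ?_⟩
    · refine tendsto_const_nhds.congr' ?_
      filter_upwards [eventually_gt_atTop 0] with n hn
      exact (geomDistillability_eq_zero (tensorPow_mem_nondistillableStates hρn hn)).symm
    · refine tendsto_const_nhds.congr' ?_
      filter_upwards [eventually_gt_atTop 0] with n hn
      exact (traceDistillability_eq_zero (tensorPow_mem_nondistillableStates hρn hn)).symm
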